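/- Let $(A,\Delta)$ be a regular weak multiplier Hopf algebra over $\mathbb C$: $A$ is a non-degenerate idempotent algebra (with or without unit), $\Delta:A\to M(A\otimes A)$ is a regular full coassociative coproduct with a counit, there is a canonical idempotent $E\in M(A\otimes A)$ that determines the ranges and the kernels of the canonical maps $a\otimes b\mapsto\Delta(a)(1\otimes b)$ and $c\otimes a\mapsto(c\otimes1)\Delta(a)$, with $(\Delta\otimes\iota)(E)=(\iota\otimes\Delta)(E)=(E\otimes1)(1\otimes E)=(1\otimes E)(E\otimes1)$, and the antipode $S$ is a bijective map from $A$ to $A$. Here $M(\cdot)$ denotes the multiplier algebra and $\iota$ the identity map. Let $\varepsilon_s(a)=\sum S(a_{(1)})a_{(2)}$ and $\varepsilon_t(a)=\sum a_{(1)}S(a_{(2)})$ be the source and target maps $A\to M(A)$, and let $A_s=M(\varepsilon_s(A))$ and $A_t=M(\varepsilon_t(A))$, considered as subalgebras of $M(A)$. A left integral is a non-zero linear functional $\varphi$ on $A$ with $(\iota\otimes\varphi)\Delta(a)\in A_t$ for all $a\in A$; a right integral is a non-zero linear functional $\psi$ on $A$ with $(\psi\otimes\iota)\Delta(a)\in A_s$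 for all $a\in A$. Let $\varphi$ be any left integral, $\psi$ any right integral, and $p,q\in A$. i) We have $\psi(xa)=\varphi(xb)$ for all $x\in A$ if $$a=(\iota\otimes\varphi)\big((\iota\otimes S)(\Delta(p))(1\otimes q)\big),\qquad b=(\psi\otimes\iota)\big((S^{-1}\otimes\iota)(\Delta(q))(p\otimes1)\big).$$ ii) We have $\psi(ax)=\varphi(bx)$ for all $x\in A$ if $$a=(\iota\otimes\varphi)\big((1\otimes q)(\iota\otimes S^{-1})\Delta(p)\big),\qquad b=(\psi\otimes\iota)\big((p\otimes1)(S\otimes\iota)\Delta(q)\big).$$ iii) We have $\psi(xa)=\varphi(bx)$ for all $x\in A$ if $$a=(\iota\otimes\varphi)\big((1\otimes q)(\iota\otimes S)\Delta(p)\big),\qquad b=(\psi\otimes\iota)\big((S\otimes\iota)(\Delta(q))(p\otimes1)\big).$$ iv) We have $\psi(ax)=\varphi(xb)$ for all $x\in A$ if $$a=(\iota\otimes\varphi)\big((\iota\otimes S^{-1})(\Delta(p))(1\otimes q)\big),\qquad b=(\psi\otimes\iota)\big((p\otimes1)(S^{-1}\otimes\iota)\Delta(q)\big).$$ Here, for $F=S$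 or $F=S^{-1}$, which reverses products, the expressions in the brackets are the elements of $A\otimes A$ given by $(\iota\otimes F)(\Delta(p))(1\otimes q)=(\iota\otimes F)((1\otimes F^{-1}(q))\Delta(p))$, $(1\otimes q)(\iota\otimes F)\Delta(p)=(\iota\otimes F)(\Delta(p)(1\otimes F^{-1}(q)))$, $(F\otimes\iota)(\Delta(q))(p\otimes1)=(F\otimes\iota)((F^{-1}(p)\otimes1)\Delta(q))$ and $(p\otimes1)(F\otimes\iota)\Delta(q)=(F\otimes\iota)(\Delta(q)(F^{-1}(p)\otimes1))$. -/

import Mathlib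

open scoped TensorProduct

noncomputable section

namespace WMHA

section Multipliers

variable (A : Type*) [NonUnitalRing A] [Module ℂ A] [IsScalarTower ℂ A A] [SMulCommClass ℂ A A]

/-- The product of `A` is non-degenerate. -/
def IsNondegenerate : Prop :=
  (∀ a : A, (∀ b : A, a * b = 0) → a = 0) ∧ (∀ a : A, (∀ b : A, b * a = 0) → a = 0)

/-- `A² = A`: every element of `A` is a finite sum of products. -/
def IsIdempotentAlgebra : Prop := LinearMap.range (LinearMap.mul' ℂ A) = ⊤

/-- The multiplier algebra `M(A)`: pairs of linear maps `b ↦ m b` and `c ↦ c m` of `A` with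
`(c m) b = c (m b)`. The product and the unit are those of composition of operators
(reversed in the second component, since `c (m n) = (c m) n`). -/
def MultiplierAlgebra : Subalgebra ℂ (Module.End ℂ A × (Module.End ℂ A)ᵐᵒᵖ) where
  carrier := {m | ∀ c b : A, m.2.unop c * b = c * m.1 b}
  mul_mem' := by
    intro m n hm hn c b
    have h1 := hn (m.2.unop c) b
    have h2 := hm c (n.1 b)
    simpa using h1.trans h2
  add_mem' := by
    intro m n hm hn c b
    simp only [Set.mem_ofPred_eq] at hm hn
    simp [add_mul, mul_add, hm c b, hn c b]
  algebraMap_mem' := by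
    intro r c b
    simp [Module.algebraMap_end_apply, smul_mul_assoc, mul_smul_comm]

variable {A}

/-- The operator `b ↦ m b`. -/
def lact (m : MultiplierAlgebra A) : A →ₗ[ℂ] A := m.1.1

/-- The operator `c ↦ c m`. -/
def ract (m : MultiplierAlgebra A) : A →ₗ[ℂ] A := m.1.2.unop

/-- The multiplier `m` with `m b = l b` and `c m = r c`. -/
def mkMultiplier (l r : A →ₗ[ℂ] A) (h : ∀ c b : A, r c * b = c * l b) :
    MultiplierAlgebra A :=
  ⟨(l, MulOpposite.op r), h⟩

/-- The canonical map `A → M(A)`. -/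
def toMultiplier (a : A) : MultiplierAlgebra A :=
  mkMultiplier (LinearMap.mulLeft ℂ a) (LinearMap.mulRight ℂ a)
    (fun c b => by simp [mul_assoc])

/-- The multiplier `c ⊗ 1` of `A ⊗ A`. -/
def tensorOne (c : A) : MultiplierAlgebra (A ⊗[ℂ] A) :=
  mkMultiplier (TensorProduct.map (LinearMap.mulLeft ℂ c) LinearMap.id)
    (TensorProduct.map (LinearMap.mulRight ℂ c) LinearMap.id) (by
      intro x y
      induction x with
      | zero => simp
      | add x₁ x₂ h₁ h₂ => simp only [map_add, add_mul, h₁, h₂]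
      | tmul p q =>
        induction y with
        | zero => simp
        | add y₁ y₂ h₁ h₂ => simp only [map_add, mul_add, h₁, h₂]
        | tmul r s => simp [mul_assoc])

/-- The multiplier `1 ⊗ b` of `A ⊗ A`. -/
def oneTensor (b : A) : MultiplierAlgebra (A ⊗[ℂ] A) :=
  mkMultiplier (TensorProduct.map LinearMap.id (LinearMap.mulLeft ℂ b))
    (TensorProduct.map LinearMap.id (LinearMap.mulRight ℂ b)) (by
      intro x y
      induction x with
      | zero => simp
      | add x₁ x₂ h₁ h₂ => simp only [map_add, add_mul, h₁, h₂]
      | tmul p q =>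
        induction y with
        | zero => simp
        | add y₁ y₂ h₁ h₂ => simp only [map_add, mul_add, h₁, h₂]
        | tmul r s => simp [mul_assoc])

/-- The slice map `ι ⊗ ω : A ⊗ A → A`, `p ⊗ q ↦ ω(q) p`. -/
def sliceSnd (ω : A →ₗ[ℂ] ℂ) : A ⊗[ℂ] A →ₗ[ℂ] A :=
  (TensorProduct.rid ℂ A).toLinearMap ∘ₗ TensorProduct.map LinearMap.id ω

/-- The slice map `ω ⊗ ι : A ⊗ A → A`, `p ⊗ q ↦ ω(p) q`. -/
def sliceFst (ω : A →ₗ[ℂ] ℂ) : A ⊗[ℂ] A →ₗ[ℂ] A :=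
  (TensorProduct.lid ℂ A).toLinearMap ∘ₗ TensorProduct.map ω LinearMap.id

/-- For `f : A ⊗ A → A ⊗ A`, the map `f ⊗ ι` on `A ⊗ (A ⊗ A)`. -/
def onFstTwo (f : A ⊗[ℂ] A →ₗ[ℂ] A ⊗[ℂ] A) :
    A ⊗[ℂ] (A ⊗[ℂ] A) →ₗ[ℂ] A ⊗[ℂ] (A ⊗[ℂ] A) :=
  (TensorProduct.assoc ℂ A A A).toLinearMap ∘ₗ TensorProduct.map f LinearMap.id ∘ₗ
    (TensorProduct.assoc ℂ A A A).symm.toLinearMap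

/-- For `f : A ⊗ A → A ⊗ A`, the map `ι ⊗ f` on `A ⊗ (A ⊗ A)`. -/
def onLastTwo (f : A ⊗[ℂ] A →ₗ[ℂ] A ⊗[ℂ] A) :
    A ⊗[ℂ] (A ⊗[ℂ] A) →ₗ[ℂ] A ⊗[ℂ] (A ⊗[ℂ] A) :=
  TensorProduct.map LinearMap.id f

/-- For `f : A ⊗ A → A ⊗ A`, the map on `A ⊗ (A ⊗ A)` that applies `f` to the first and the third
tensor factor. -/
def onOuterTwo (f : A ⊗[ℂ] A →ₗ[ℂ] A ⊗[ℂ] A) :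
    A ⊗[ℂ] (A ⊗[ℂ] A) →ₗ[ℂ] A ⊗[ℂ] (A ⊗[ℂ] A) :=
  (TensorProduct.leftComm ℂ A A A).toLinearMap ∘ₗ onLastTwo f ∘ₗ
    (TensorProduct.leftComm ℂ A A A).toLinearMap

end Multipliers

/-- A weak multiplier Hopf algebra structure on a non-degenerate idempotent complex algebra `A`.
All data are determined by `Δ`: `T₁` and `T₂` are the canonical maps, `ε` is the counit, `E` is the
canonical idempotent, and `G₁`, `G₂` are the idempotent maps that describe the kernels of
`T₁` and `T₂`. -/
structure WeakMultiplierHopfAlgebra (A : Type*) [NonUnitalRing A] [Module ℂ A]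
    [IsScalarTower ℂ A A] [SMulCommClass ℂ A A] where
  nondegenerate : IsNondegenerate A
  idempotent : IsIdempotentAlgebra A
  /-- The coproduct, a homomorphism `A → M(A ⊗ A)`. -/
  Δ : A →ₙₐ[ℂ] MultiplierAlgebra (A ⊗[ℂ] A)
  /-- `T₁(a ⊗ b) = Δ(a)(1 ⊗ b)`, an element of `A ⊗ A`. -/
  T₁ : A ⊗[ℂ] A →ₗ[ℂ] A ⊗[ℂ] A
  T₁_spec : ∀ a b : A, toMultiplier (T₁ (a ⊗ₜ b)) = Δ a * oneTensor b
  /-- `T₂(c ⊗ a) = (c ⊗ 1)Δ(a)`, an element of `A ⊗ A`. -/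
  T₂ : A ⊗[ℂ] A →ₗ[ℂ] A ⊗[ℂ] A
  T₂_spec : ∀ c a : A, toMultiplier (T₂ (c ⊗ₜ a)) = tensorOne c * Δ a
  /-- Coassociativity: on `c ⊗ a ⊗ b` it reads
  `(c ⊗ 1 ⊗ 1)(Δ ⊗ ι)(Δ(a)(1 ⊗ b)) = (ι ⊗ Δ)((c ⊗ 1)Δ(a))(1 ⊗ 1 ⊗ b)`. -/
  coassoc : onFstTwo T₂ ∘ₗ onLastTwo T₁ = onLastTwo T₁ ∘ₗ onFstTwo T₂
  /-- The coproduct is full: its left leg is all of `A`. -/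
  full_left : Submodule.span ℂ {x : A | ∃ (a b : A) (ω : A →ₗ[ℂ] ℂ),
    x = sliceSnd ω (T₁ (a ⊗ₜ b))} = ⊤
  /-- The coproduct is full: its right leg is all of `A`. -/
  full_right : Submodule.span ℂ {x : A | ∃ (c a : A) (ω : A →ₗ[ℂ] ℂ),
    x = sliceFst ω (T₂ (c ⊗ₜ a))} = ⊤
  /-- The counit. -/
  ε : A →ₗ[ℂ] ℂ
  counit_left : ∀ a b : A, sliceFst ε (T₁ (a ⊗ₜ b)) = a * b
  counit_right : ∀ c a : A, sliceSnd ε (T₂ (c ⊗ₜ a)) = c * a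
  /-- The canonical idempotent. -/
  E : MultiplierAlgebra (A ⊗[ℂ] A)
  E_idem : E * E = E
  /-- `Δ(A)(1 ⊗ A) = E(A ⊗ A)`. -/
  range_T₁ : LinearMap.range T₁ = LinearMap.range (lact E)
  /-- `(A ⊗ 1)Δ(A) = (A ⊗ A)E`. -/
  range_T₂ : LinearMap.range T₂ = LinearMap.range (ract E)
  /-- `(E ⊗ 1)(1 ⊗ E) = (1 ⊗ E)(E ⊗ 1)`. -/
  E_comm : onFstTwo (lact E) ∘ₗ onLastTwo (lact E) = onLastTwo (lact E) ∘ₗ onFstTwo (lact E)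
  /-- `(ι ⊗ Δ)(E) = (E ⊗ 1)(1 ⊗ E)`. The multiplier `(ι ⊗ Δ)(E)` is the `X` with `X = X(1 ⊗ E)` and
  `X · (ι ⊗ Δ)(z)(1 ⊗ 1 ⊗ c) = (ι ⊗ Δ)(E z)(1 ⊗ 1 ⊗ c)` for `z ∈ A ⊗ A` and `c ∈ A`. -/
  Δ_right_leg : (onFstTwo (lact E) ∘ₗ onLastTwo (lact E)) ∘ₗ onLastTwo T₁ =
    onLastTwo T₁ ∘ₗ onFstTwo (lact E)
  /-- `(Δ ⊗ ι)(E) = (1 ⊗ E)(E ⊗ 1)`. The multiplier `(Δ ⊗ ι)(E)` is the `X` with `X = (E ⊗ 1)X` and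
  `(c ⊗ 1 ⊗ 1)(Δ ⊗ ι)(z) · X = (c ⊗ 1 ⊗ 1)(Δ ⊗ ι)(z E)` for `z ∈ A ⊗ A` and `c ∈ A`. -/
  Δ_left_leg : (onFstTwo (ract E) ∘ₗ onLastTwo (ract E)) ∘ₗ onFstTwo T₂ =
    onFstTwo T₂ ∘ₗ onLastTwo (ract E)
  /-- `(G₁ ⊗ ι)(Δ₁₃(a)(1 ⊗ b ⊗ c)) = Δ₁₃(a)(1 ⊗ E)(1 ⊗ b ⊗ c)`. -/
  G₁ : A ⊗[ℂ] A →ₗ[ℂ] A ⊗[ℂ] A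
  G₁_spec : onFstTwo G₁ ∘ₗ onOuterTwo T₁ = onOuterTwo T₁ ∘ₗ onLastTwo (lact E)
  /-- `(ι ⊗ G₂)((a ⊗ b ⊗ 1)Δ₁₃(c)) = (a ⊗ b ⊗ 1)(E ⊗ 1)Δ₁₃(c)`. -/
  G₂ : A ⊗[ℂ] A →ₗ[ℂ] A ⊗[ℂ] A
  G₂_spec : onLastTwo G₂ ∘ₗ onOuterTwo T₂ = onOuterTwo T₂ ∘ₗ onFstTwo (ract E)
  ker_T₁ : LinearMap.ker T₁ = LinearMap.range (LinearMap.id - G₁)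
  ker_T₂ : LinearMap.ker T₂ = LinearMap.range (LinearMap.id - G₂)

/-- A regular weak multiplier Hopf algebra: the coproduct is regular, that is `(1 ⊗ b)Δ(a)` and
`Δ(a)(b ⊗ 1)` also lie in `A ⊗ A`, and the antipode is a bijective map `S : A → A`. The antipode is
the unique map for which `R₁(a ⊗ b) = ∑ a₍₁₎ ⊗ S(a₍₂₎)b` and `R₂(a ⊗ b) = ∑ a S(b₍₁₎) ⊗ b₍₂₎`
are the canonical generalized inverses of `T₁` and `T₂`. Again all data are determined by `Δ`. -/
structure RegularWeakMultiplierHopfAlgebra (A : Type*) [NonUnitalRing A] [Module ℂ A]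
    [IsScalarTower ℂ A A] [SMulCommClass ℂ A A] extends WeakMultiplierHopfAlgebra A where
  /-- `T₃(a ⊗ b) = (1 ⊗ b)Δ(a)`. -/
  T₃ : A ⊗[ℂ] A →ₗ[ℂ] A ⊗[ℂ] A
  T₃_spec : ∀ a b : A, toMultiplier (T₃ (a ⊗ₜ b)) = oneTensor b * Δ a
  /-- `T₄(b ⊗ a) = Δ(a)(b ⊗ 1)`. -/
  T₄ : A ⊗[ℂ] A →ₗ[ℂ] A ⊗[ℂ] A
  T₄_spec : ∀ b a : A, toMultiplier (T₄ (b ⊗ₜ a)) = Δ a * tensorOne b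
  /-- The antipode. -/
  S : A ≃ₗ[ℂ] A
  R₁ : A ⊗[ℂ] A →ₗ[ℂ] A ⊗[ℂ] A
  R₂ : A ⊗[ℂ] A →ₗ[ℂ] A ⊗[ℂ] A
  /-- `R₁(a ⊗ b) = ∑ a₍₁₎ ⊗ S(a₍₂₎)b`, covered by `c` from the left in the first factor. -/
  R₁_spec : ∀ a b c : A, TensorProduct.map (LinearMap.mulLeft ℂ c) LinearMap.id (R₁ (a ⊗ₜ b)) =
    TensorProduct.map LinearMap.id (LinearMap.mulRight ℂ b ∘ₗ S.toLinearMap) (T₂ (c ⊗ₜ a))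
  /-- `R₂(a ⊗ b) = ∑ a S(b₍₁₎) ⊗ b₍₂₎`, covered by `c` from the right in the second factor. -/
  R₂_spec : ∀ a b c : A, TensorProduct.map LinearMap.id (LinearMap.mulRight ℂ c) (R₂ (a ⊗ₜ b)) =
    TensorProduct.map (LinearMap.mulLeft ℂ a ∘ₗ S.toLinearMap) LinearMap.id (T₁ (b ⊗ₜ c))
  T₁_R₁ : T₁ ∘ₗ R₁ = (lact E)
  R₁_T₁ : R₁ ∘ₗ T₁ = G₁
  R₁_T₁_R₁ : R₁ ∘ₗ T₁ ∘ₗ R₁ = R₁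
  T₂_R₂ : T₂ ∘ₗ R₂ = (ract E)
  R₂_T₂ : R₂ ∘ₗ T₂ = G₂
  R₂_T₂_R₂ : R₂ ∘ₗ T₂ ∘ₗ R₂ = R₂

section Helpers

variable {A : Type*} [NonUnitalRing A] [Module ℂ A]

lemma sliceSnd_map_left (ω : A →ₗ[ℂ] ℂ) (f : A →ₗ[ℂ] A) (z : A ⊗[ℂ] A) :
    sliceSnd ω (TensorProduct.map f LinearMap.id z) = f (sliceSnd ω z) := by
  induction z with
  | zero => simp
  | add x y hx hy => simp only [map_add, hx, hy]
  | tmul p q => simp [sliceSnd]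

lemma sliceFst_map_right (ω : A →ₗ[ℂ] ℂ) (f : A →ₗ[ℂ] A) (z : A ⊗[ℂ] A) :
    sliceFst ω (TensorProduct.map LinearMap.id f z) = f (sliceFst ω z) := by
  induction z with
  | zero => simp
  | add x y hx hy => simp only [map_add, hx, hy]
  | tmul p q => simp [sliceFst]

lemma sliceSnd_map (ω : A →ₗ[ℂ] ℂ) (f g : A →ₗ[ℂ] A) (z : A ⊗[ℂ] A) :
    sliceSnd ω (TensorProduct.map f g z) = f (sliceSnd (ω ∘ₗ g) z) := by
  induction z with
  | zero => simp
  | add x y hx hy => simp only [map_add, hx, hy]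
  | tmul p q => simp [sliceSnd]

lemma apply_sliceFst (ω η : A →ₗ[ℂ] ℂ) (z : A ⊗[ℂ] A) :
    η (sliceFst ω z) = ω (sliceSnd η z) := by
  induction z with
  | zero => simp
  | add x y hx hy => simp only [map_add, hx, hy]
  | tmul p q => simp [sliceFst, sliceSnd, mul_comm]

lemma eq_zero_of_sliceFst {z : A ⊗[ℂ] A} (h : ∀ ω : A →ₗ[ℂ] ℂ, sliceFst ω z = 0) : z = 0 := by
  let b := Module.Free.chooseBasis ℂ A
  have hcoord : ∀ i, TensorProduct.equivFinsuppOfBasisLeft (N := A) b z i =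
      sliceFst (b.coord i) z := by
    intro i
    generalize z = w
    induction w with
    | zero => simp
    | add x y hx hy => simp only [map_add, Finsupp.add_apply, hx, hy]
    | tmul p q => simp [sliceFst]
  apply (TensorProduct.equivFinsuppOfBasisLeft (N := A) b).injective
  ext i
  rw [hcoord i, h, map_zero, Finsupp.zero_apply]

variable [IsScalarTower ℂ A A] [SMulCommClass ℂ A A]

lemma mul_tmul_eq_map (z : A ⊗[ℂ] A) (b b' : A) :
    z * (b ⊗ₜ b') = TensorProduct.map (LinearMap.mulRight ℂ b) (LinearMap.mulRight ℂ b') z := by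
  induction z with
  | zero => simp
  | add x y hx hy => simp only [map_add, add_mul, hx, hy]
  | tmul p q => simp

/-- If `A` is non-degenerate, an element of `A ⊗ A` is determined by left multiplication with it. -/
lemma tensor_ext (hA : IsNondegenerate A) {z w : A ⊗[ℂ] A} (h : ∀ y, z * y = w * y) : z = w := by
  have hmul : ∀ y, (z - w) * y = 0 := fun y => by rw [sub_mul, h y, sub_self]
  rw [← sub_eq_zero]
  generalize z - w = x at hmul
  apply eq_zero_of_sliceFst
  intro ω
  apply hA.1
  intro b'
  rw [← Module.forall_dual_apply_eq_zero_iff ℂ]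
  intro η
  change (η ∘ₗ LinearMap.mulRight ℂ b') (sliceFst ω x) = 0
  rw [apply_sliceFst]
  have hu : sliceSnd (η ∘ₗ LinearMap.mulRight ℂ b') x = 0 := by
    apply hA.1
    intro b
    have h3 := sliceSnd_map η (LinearMap.mulRight ℂ b) (LinearMap.mulRight ℂ b') x
    rw [← mul_tmul_eq_map, hmul, map_zero] at h3
    exact h3.symm
  rw [hu, map_zero]

lemma mul'_map_mulLeft (c : A) (z : A ⊗[ℂ] A) :
    LinearMap.mul' ℂ A (TensorProduct.map (LinearMap.mulLeft ℂ c) LinearMap.id z) =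
      c * LinearMap.mul' ℂ A z := by
  induction z with
  | zero => simp
  | add x y hx hy => simp only [map_add, hx, hy, mul_add]
  | tmul p q => simp [mul_assoc]

lemma mul'_map_mulRight (b : A) (f : A →ₗ[ℂ] A) (z : A ⊗[ℂ] A) :
    LinearMap.mul' ℂ A (TensorProduct.map f (LinearMap.mulRight ℂ b) z) =
      LinearMap.mul' ℂ A (TensorProduct.map f LinearMap.id z) * b := by
  induction z with
  | zero => simp
  | add x y hx hy => simp only [map_add, hx, hy, add_mul]
  | tmul p q => simp [mul_assoc]

lemma mul'_map_mulLeft_comp (c : A) (g : A →ₗ[ℂ] A) (z : A ⊗[ℂ] A) :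
    LinearMap.mul' ℂ A (TensorProduct.map (LinearMap.mulLeft ℂ c ∘ₗ g) LinearMap.id z) =
      c * LinearMap.mul' ℂ A (TensorProduct.map g LinearMap.id z) := by
  induction z with
  | zero => simp
  | add x y hx hy => simp only [map_add, hx, hy, mul_add]
  | tmul p q => simp [mul_assoc]

lemma mul'_map_mulRight_comp (b : A) (g : A →ₗ[ℂ] A) (z : A ⊗[ℂ] A) :
    LinearMap.mul' ℂ A (TensorProduct.map LinearMap.id (LinearMap.mulRight ℂ b ∘ₗ g) z) =
      LinearMap.mul' ℂ A (TensorProduct.map LinearMap.id g z) * b := by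
  induction z with
  | zero => simp
  | add x y hx hy => simp only [map_add, hx, hy, add_mul]
  | tmul p q => simp [mul_assoc]

lemma map_mulRight_id_mul (b : A) (z w : A ⊗[ℂ] A) :
    TensorProduct.map (LinearMap.mulRight ℂ b) LinearMap.id z * w =
      z * TensorProduct.map (LinearMap.mulLeft ℂ b) LinearMap.id w :=
  (tensorOne b).2 z w

lemma map_id_mulRight_mul (b : A) (z w : A ⊗[ℂ] A) :
    TensorProduct.map LinearMap.id (LinearMap.mulRight ℂ b) z * w =
      z * TensorProduct.map LinearMap.id (LinearMap.mulLeft ℂ b) w :=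
  (oneTensor b).2 z w

lemma map_mulLeft_id_mul (c : A) (z w : A ⊗[ℂ] A) :
    TensorProduct.map (LinearMap.mulLeft ℂ c) LinearMap.id z * w =
      TensorProduct.map (LinearMap.mulLeft ℂ c) LinearMap.id (z * w) := by
  induction z with
  | zero => simp
  | add x₁ x₂ h₁ h₂ => simp only [map_add, add_mul, h₁, h₂]
  | tmul p q =>
    induction w with
    | zero => simp
    | add y₁ y₂ h₁ h₂ => simp only [map_add, mul_add, h₁, h₂]
    | tmul r s => simp [mul_assoc]

lemma map_id_mulLeft_mul (c : A) (z w : A ⊗[ℂ] A) :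
    TensorProduct.map LinearMap.id (LinearMap.mulLeft ℂ c) z * w =
      TensorProduct.map LinearMap.id (LinearMap.mulLeft ℂ c) (z * w) := by
  induction z with
  | zero => simp
  | add x₁ x₂ h₁ h₂ => simp only [map_add, add_mul, h₁, h₂]
  | tmul p q =>
    induction w with
    | zero => simp
    | add y₁ y₂ h₁ h₂ => simp only [map_add, mul_add, h₁, h₂]
    | tmul r s => simp [mul_assoc]

end Helpers

section SourceTarget

variable {A : Type*} [NonUnitalRing A] [Module ℂ A] [IsScalarTower ℂ A A] [SMulCommClass ℂ A A]

namespace RegularWeakMultiplierHopfAlgebra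

variable (H : RegularWeakMultiplierHopfAlgebra A)

/-- `((c ⊗ 1)Δ(a))(b ⊗ 1) = (c ⊗ 1)(Δ(a)(b ⊗ 1))` in `A ⊗ A`. -/
lemma T₂_mul_tensorOne (a b c : A) :
    TensorProduct.map (LinearMap.mulRight ℂ b) LinearMap.id (H.T₂ (c ⊗ₜ a)) =
      TensorProduct.map (LinearMap.mulLeft ℂ c) LinearMap.id (H.T₄ (b ⊗ₜ a)) := by
  apply tensor_ext H.nondegenerate
  intro w
  have h2 : ∀ y, H.T₂ (c ⊗ₜ a) * y = TensorProduct.map (LinearMap.mulLeft ℂ c) LinearMap.id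
      (lact (H.Δ a) y) := fun y => congrArg (fun m => lact m y) (H.T₂_spec c a)
  have h4 : ∀ y, H.T₄ (b ⊗ₜ a) * y = lact (H.Δ a)
      (TensorProduct.map (LinearMap.mulLeft ℂ b) LinearMap.id y) :=
    fun y => congrArg (fun m => lact m y) (H.T₄_spec b a)
  rw [map_mulRight_id_mul, map_mulLeft_id_mul, h2, h4]

/-- `((1 ⊗ c)Δ(a))(1 ⊗ b) = (1 ⊗ c)(Δ(a)(1 ⊗ b))` in `A ⊗ A`. -/
lemma T₃_mul_oneTensor (a b c : A) :
    TensorProduct.map LinearMap.id (LinearMap.mulRight ℂ b) (H.T₃ (a ⊗ₜ c)) =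
      TensorProduct.map LinearMap.id (LinearMap.mulLeft ℂ c) (H.T₁ (a ⊗ₜ b)) := by
  apply tensor_ext H.nondegenerate
  intro w
  have h3 : ∀ y, H.T₃ (a ⊗ₜ c) * y = TensorProduct.map LinearMap.id (LinearMap.mulLeft ℂ c)
      (lact (H.Δ a) y) := fun y => congrArg (fun m => lact m y) (H.T₃_spec a c)
  have h1 : ∀ y, H.T₁ (a ⊗ₜ b) * y = lact (H.Δ a)
      (TensorProduct.map LinearMap.id (LinearMap.mulLeft ℂ b) y) :=
    fun y => congrArg (fun m => lact m y) (H.T₁_spec a b)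
  rw [map_id_mulRight_mul, map_id_mulLeft_mul, h3, h1]

/-- The multiplier `(ι ⊗ ω)Δ(a)`: it is the `x ∈ M(A)` with `x b = (ι ⊗ ω)(Δ(a)(b ⊗ 1))` and
`c x = (ι ⊗ ω)((c ⊗ 1)Δ(a))`. -/
def sliceSndΔ (ω : A →ₗ[ℂ] ℂ) (a : A) : MultiplierAlgebra A :=
  mkMultiplier (sliceSnd ω ∘ₗ H.T₄ ∘ₗ (TensorProduct.mk ℂ A A).flip a)
    (sliceSnd ω ∘ₗ H.T₂ ∘ₗ (TensorProduct.mk ℂ A A).flip a) (by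
      intro c b
      have h := congrArg (sliceSnd ω) (H.T₂_mul_tensorOne a b c)
      rw [sliceSnd_map_left, sliceSnd_map_left] at h
      exact h)

/-- The multiplier `(ω ⊗ ι)Δ(a)`: it is the `x ∈ M(A)` with `x b = (ω ⊗ ι)(Δ(a)(1 ⊗ b))` and
`c x = (ω ⊗ ι)((1 ⊗ c)Δ(a))`. -/
def sliceFstΔ (ω : A →ₗ[ℂ] ℂ) (a : A) : MultiplierAlgebra A :=
  mkMultiplier (sliceFst ω ∘ₗ H.T₁ ∘ₗ TensorProduct.mk ℂ A A a)
    (sliceFst ω ∘ₗ H.T₃ ∘ₗ TensorProduct.mk ℂ A A a) (by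
      intro c b
      have h := congrArg (sliceFst ω) (H.T₃_mul_oneTensor a b c)
      rw [sliceFst_map_right, sliceFst_map_right] at h
      exact h)

/-- The source map `ε_s(a) = ∑ S(a₍₁₎)a₍₂₎ ∈ M(A)`. -/
def sourceMap (a : A) : MultiplierAlgebra A :=
  mkMultiplier
    (LinearMap.mul' ℂ A ∘ₗ TensorProduct.map H.S.toLinearMap LinearMap.id ∘ₗ H.T₁ ∘ₗ
      TensorProduct.mk ℂ A A a)
    (LinearMap.mul' ℂ A ∘ₗ H.R₂ ∘ₗ (TensorProduct.mk ℂ A A).flip a) (by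
      intro c b
      have h := congrArg (LinearMap.mul' ℂ A) (H.R₂_spec c a b)
      rw [mul'_map_mulRight, mul'_map_mulLeft_comp] at h
      simpa using h)

/-- The target map `ε_t(a) = ∑ a₍₁₎S(a₍₂₎) ∈ M(A)`. -/
def targetMap (a : A) : MultiplierAlgebra A :=
  mkMultiplier
    (LinearMap.mul' ℂ A ∘ₗ H.R₁ ∘ₗ TensorProduct.mk ℂ A A a)
    (LinearMap.mul' ℂ A ∘ₗ TensorProduct.map LinearMap.id H.S.toLinearMap ∘ₗ H.T₂ ∘ₗ
      (TensorProduct.mk ℂ A A).flip a) (by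
      intro c b
      have h := congrArg (LinearMap.mul' ℂ A) (H.R₁_spec a b c)
      rw [mul'_map_mulLeft, mul'_map_mulRight_comp] at h
      simpa using h.symm)

/-- `A_s`, the multiplier algebra of the source algebra `ε_s(A)`, as it sits in `M(A)`: the
multipliers `x` with `x ε_s(A) ⊆ ε_s(A)` and `ε_s(A) x ⊆ ε_s(A)`. -/
def As : Set (MultiplierAlgebra A) :=
  {x | ∀ y ∈ Set.range H.sourceMap, x * y ∈ Set.range H.sourceMap ∧ y * x ∈ Set.range H.sourceMap}

/-- `A_t`, the multiplier algebra of the target algebra `ε_t(A)`, as it sits in `M(A)`: the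
multipliers `x` with `x ε_t(A) ⊆ ε_t(A)` and `ε_t(A) x ⊆ ε_t(A)`. -/
def At : Set (MultiplierAlgebra A) :=
  {x | ∀ y ∈ Set.range H.targetMap, x * y ∈ Set.range H.targetMap ∧ y * x ∈ Set.range H.targetMap}

/-- A left integral: a non-zero functional `φ` with `(ι ⊗ φ)Δ(a) ∈ A_t` for all `a`. -/
def IsLeftIntegral (φ : A →ₗ[ℂ] ℂ) : Prop := φ ≠ 0 ∧ ∀ a : A, H.sliceSndΔ φ a ∈ H.At

/-- A right integral: a non-zero functional `ψ` with `(ψ ⊗ ι)Δ(a) ∈ A_s` for all `a`. -/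
def IsRightIntegral (ψ : A →ₗ[ℂ] ℂ) : Prop := ψ ≠ 0 ∧ ∀ a : A, H.sliceFstΔ ψ a ∈ H.As

/-! In the next four definitions `F` is an anti-automorphism of `A` (the antipode or its inverse).
Since `F` reverses products, an element `q` outside `F` is the element `F⁻¹(q)` on the other side
inside `F`, where it covers the leg of `Δ` to which `F` is applied. -/

/-- `(ι ⊗ F)(Δ(p))(1 ⊗ q) = ∑ p₍₁₎ ⊗ F(p₍₂₎)q = (ι ⊗ F)((1 ⊗ F⁻¹(q))Δ(p))`. -/
def sndΔMul (F : A ≃ₗ[ℂ] A) (p q : A) : A ⊗[ℂ] A :=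
  TensorProduct.map LinearMap.id F.toLinearMap (H.T₃ (p ⊗ₜ F.symm q))

/-- `(1 ⊗ q)(ι ⊗ F)Δ(p) = ∑ p₍₁₎ ⊗ qF(p₍₂₎) = (ι ⊗ F)(Δ(p)(1 ⊗ F⁻¹(q)))`. -/
def mulSndΔ (F : A ≃ₗ[ℂ] A) (q p : A) : A ⊗[ℂ] A :=
  TensorProduct.map LinearMap.id F.toLinearMap (H.T₁ (p ⊗ₜ F.symm q))

/-- `(F ⊗ ι)(Δ(q))(p ⊗ 1) = ∑ F(q₍₁₎)p ⊗ q₍₂₎ = (F ⊗ ι)((F⁻¹(p) ⊗ 1)Δ(q))`. -/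
def fstΔMul (F : A ≃ₗ[ℂ] A) (q p : A) : A ⊗[ℂ] A :=
  TensorProduct.map F.toLinearMap LinearMap.id (H.T₂ (F.symm p ⊗ₜ q))

/-- `(p ⊗ 1)(F ⊗ ι)Δ(q) = ∑ pF(q₍₁₎) ⊗ q₍₂₎ = (F ⊗ ι)(Δ(q)(F⁻¹(p) ⊗ 1))`. -/
def mulFstΔ (F : A ≃ₗ[ℂ] A) (p q : A) : A ⊗[ℂ] A :=
  TensorProduct.map F.toLinearMap LinearMap.id (H.T₄ (F.symm p ⊗ₜ q))

end RegularWeakMultiplierHopfAlgebra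

end SourceTarget

end WMHA

end

/-!
Each of the four identities holds because both of its sides are the same scalar, namely
`(ψ ⊗ φ)` applied to `Δ(x)` multiplied with `p ⊗ q`: on the right in (i), on the left in (ii), and
on different sides in (iii) and (iv). That reduction uses only that the antipode `S` reverses
products (`S_mul`) and the two antipode relations of integrals,

* `S((ι ⊗ φ)(Δ(x)(1 ⊗ q))) = (ι ⊗ φ)((1 ⊗ x)Δ(q))` for a left integral `φ` (`S_sndSlice_T₁`),
* `S((ψ ⊗ ι)((x ⊗ 1)Δ(p))) = (ψ ⊗ ι)(Δ(x)(p ⊗ 1))` for a right integral `ψ` (`S_fstSlice_T₂`).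

The second relation is the first one for the opposite algebra with the opposite coproduct. To make
this available, the structure is repackaged as linear maps on `A` and `A ⊗ A` (`CanonicalMaps`)
with laws that come in opposite pairs (`IsWeakHopf`, `IsWeakHopf.op`), so that every statement
yields its mirror image.

**The antipode reverses products.** Let `T₁, T₂` be the canonical maps and `R₁, R₂` the generalized
inverses given by `S`. The law `R₁T₁R₁ = R₁` gives `∑ S(E₍₁₎a)E₍₂₎b = S(a)b` (`SMul_lE`), because
the maps `x ↦ (f ⊗ ι)((c ⊗ 1)Δ(x))` commute with left multiplication by the left leg of `E`, and
their values span `A`. With `T₁R₁ = E` and `ε_s(ab) = ∑ S(b₍₁₎)ε_s(a)b₍₂₎`, this gives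
`S(ab) = S(b)S(a)`.

**The antipode relation.** A right multiplication `g` with an element of `A_t` satisfies
`Δ(g(p)) = (g ⊗ ι)Δ(p)`, so it is determined by `ε ∘ g` (`eq_of_counit_comp_eq`). From
`ε(aε_t(b)) = ε(ab)` (`counit_etr`) and `ε ∘ S = ε` (`counit_S`) follows first
`∑ S(E₍₁₎)ε(E₍₂₎q) = ε_t(q)` (`rSLeftLeg_counit`), and hence
`(S ⊗ ι)(E(b ⊗ q)) = ∑ S(b)ε_t(q₍₁₎) ⊗ q₍₂₎` (`S_lE`). For a left integral `φ`, the elements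
`∑ a₍₁₎φ(a₍₂₎)` and `∑ ε_t(a₍₁₎)φ(a₍₂₎)` both act as elements of `A_t`, and they agree after
application of `ε`, so they are equal (`sndSlice_R₂_T₂`). Applying `ι ⊗ φ` to `S_lE` for the
factors of `Δ(x)(d ⊗ q)` then gives the relation, since `R₂(S(d) ⊗ x)` is `(S ⊗ ι)(Δ(x)(d ⊗ 1))`
and `T₂R₂` is right multiplication with `E`.

The identity `∑ ε_s(a₍₁₎) ⊗ a₍₂₎ = (1 ⊗ a)E` on which this rests is the defining property of the
kernel of `T₁` (`map_es_T₁`), with the first leg of `Δ(a)` removed by fullness of the coproduct.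
-/

noncomputable section

namespace WMHA

open TensorProduct LinearMap

local infix:70 " ⊗ₘ " => TensorProduct.map

/-! ### Slices of tensors -/

section Slices

variable {V W : Type*} [AddCommGroup V] [Module ℂ V] [AddCommGroup W] [Module ℂ W]

/-- The slice map `f ⊗ ι : V ⊗ W → W`. -/
def fstSlice (f : V →ₗ[ℂ] ℂ) : V ⊗[ℂ] W →ₗ[ℂ] W :=
  (TensorProduct.lid ℂ W).toLinearMap ∘ₗ (f ⊗ₘ id)

/-- The slice map `ι ⊗ f : V ⊗ W → V`. -/
def sndSlice (f : W →ₗ[ℂ] ℂ) : V ⊗[ℂ] W →ₗ[ℂ] V :=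
  (TensorProduct.rid ℂ V).toLinearMap ∘ₗ (id ⊗ₘ f)

@[simp]
lemma fstSlice_tmul (f : V →ₗ[ℂ] ℂ) (a : V) (b : W) : fstSlice f (a ⊗ₜ b) = f a • b := by
  simp [fstSlice]

@[simp]
lemma sndSlice_tmul (f : W →ₗ[ℂ] ℂ) (a : V) (b : W) : sndSlice f (a ⊗ₜ b) = f b • a := by
  simp [sndSlice]

lemma fstSlice_map {V' W' : Type*} [AddCommGroup V'] [Module ℂ V'] [AddCommGroup W']
    [Module ℂ W'] (f : V' →ₗ[ℂ] ℂ) (g : V →ₗ[ℂ] V') (h : W →ₗ[ℂ] W') (z : V ⊗[ℂ] W) :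
    fstSlice f ((g ⊗ₘ h) z) = h (fstSlice (f ∘ₗ g) z) := by
  induction z with
  | zero => simp
  | add x y hx hy => simp only [map_add, hx, hy]
  | tmul p q => simp

lemma sndSlice_map {V' W' : Type*} [AddCommGroup V'] [Module ℂ V'] [AddCommGroup W']
    [Module ℂ W'] (f : W' →ₗ[ℂ] ℂ) (g : V →ₗ[ℂ] V') (h : W →ₗ[ℂ] W') (z : V ⊗[ℂ] W) :
    sndSlice f ((g ⊗ₘ h) z) = g (sndSlice (f ∘ₗ h) z) := by
  induction z with
  | zero => simp
  | add x y hx hy => simp only [map_add, hx, hy]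
  | tmul p q => simp

lemma apply_fstSlice_eq (f : V →ₗ[ℂ] ℂ) (g : W →ₗ[ℂ] ℂ) (z : V ⊗[ℂ] W) :
    g (fstSlice f z) = f (sndSlice g z) := by
  induction z with
  | zero => simp
  | add x y hx hy => simp only [map_add, hx, hy]
  | tmul p q => simp [mul_comm]

@[simp]
lemma fstSlice_comm (f : W →ₗ[ℂ] ℂ) (z : V ⊗[ℂ] W) :
    fstSlice f (TensorProduct.comm ℂ V W z) = sndSlice f z := by
  induction z with
  | zero => simp
  | add x y hx hy => simp only [map_add, hx, hy]
  | tmul p q => simp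

@[simp]
lemma sndSlice_comm (f : V →ₗ[ℂ] ℂ) (z : V ⊗[ℂ] W) :
    sndSlice f (TensorProduct.comm ℂ V W z) = fstSlice f z := by
  induction z with
  | zero => simp
  | add x y hx hy => simp only [map_add, hx, hy]
  | tmul p q => simp

lemma eq_zero_of_fstSlice {z : V ⊗[ℂ] W} (h : ∀ f : V →ₗ[ℂ] ℂ, fstSlice f z = 0) : z = 0 := by
  let b := Module.Free.chooseBasis ℂ V
  have hcoord : ∀ i, TensorProduct.equivFinsuppOfBasisLeft (N := W) b z i =
      fstSlice (b.coord i) z := by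
    intro i
    generalize z = w
    induction w with
    | zero => simp
    | add x y hx hy => simp only [map_add, Finsupp.add_apply, hx, hy]
    | tmul p q => simp
  apply (TensorProduct.equivFinsuppOfBasisLeft (N := W) b).injective
  ext i
  rw [hcoord i, h, map_zero, Finsupp.zero_apply]

lemma ext_fstSlice {z w : V ⊗[ℂ] W} (h : ∀ f : V →ₗ[ℂ] ℂ, fstSlice f z = fstSlice f w) :
    z = w :=
  sub_eq_zero.1 (eq_zero_of_fstSlice fun f => by rw [map_sub, h, sub_self])

lemma ext_sndSlice {z w : V ⊗[ℂ] W} (h : ∀ f : W →ₗ[ℂ] ℂ, sndSlice f z = sndSlice f w) :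
    z = w :=
  (TensorProduct.comm ℂ V W).injective (ext_fstSlice fun f => by simpa using h f)

lemma ext_map_fst {ι : Type*} {g : ι → V →ₗ[ℂ] V} (hg : ∀ a, (∀ i, g i a = 0) → a = 0)
    {z w : V ⊗[ℂ] W} (h : ∀ i, (g i ⊗ₘ id) z = (g i ⊗ₘ id) w) : z = w := by
  refine ext_sndSlice fun f => sub_eq_zero.1 (hg _ fun i => ?_)
  have h' := congrArg (sndSlice f) (h i)
  rw [sndSlice_map, sndSlice_map] at h'
  simpa [sub_eq_zero] using h'

lemma ext_map_snd {ι : Type*} {g : ι → W →ₗ[ℂ] W} (hg : ∀ a, (∀ i, g i a = 0) → a = 0)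
    {z w : V ⊗[ℂ] W} (h : ∀ i, (id ⊗ₘ g i) z = (id ⊗ₘ g i) w) : z = w := by
  refine ext_fstSlice fun f => sub_eq_zero.1 (hg _ fun i => ?_)
  have h' := congrArg (fstSlice f) (h i)
  rw [fstSlice_map, fstSlice_map] at h'
  simpa [sub_eq_zero] using h'

end Slices

/-! ### Canonical maps and their opposite -/

/-- The data of a regular weak multiplier Hopf algebra, given by linear maps only. The product is
a bilinear map rather than an instance, so that the opposite data live on the same vector space. -/
structure CanonicalMaps (A : Type*) [AddCommGroup A] [Module ℂ A] where
  /-- The product of `A`. -/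
  mul : A →ₗ[ℂ] A →ₗ[ℂ] A
  /-- `T₁(a ⊗ b) = Δ(a)(1 ⊗ b)`. -/
  T₁ : A ⊗[ℂ] A →ₗ[ℂ] A ⊗[ℂ] A
  /-- `T₂(c ⊗ a) = (c ⊗ 1)Δ(a)`. -/
  T₂ : A ⊗[ℂ] A →ₗ[ℂ] A ⊗[ℂ] A
  /-- `T₃(a ⊗ b) = (1 ⊗ b)Δ(a)`. -/
  T₃ : A ⊗[ℂ] A →ₗ[ℂ] A ⊗[ℂ] A
  /-- `T₄(b ⊗ a) = Δ(a)(b ⊗ 1)`. -/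
  T₄ : A ⊗[ℂ] A →ₗ[ℂ] A ⊗[ℂ] A
  /-- Left multiplication with `Δ(a)`. -/
  lΔ : A → A ⊗[ℂ] A →ₗ[ℂ] A ⊗[ℂ] A
  /-- Right multiplication with `Δ(a)`. -/
  rΔ : A → A ⊗[ℂ] A →ₗ[ℂ] A ⊗[ℂ] A
  /-- Left multiplication with `E`. -/
  lE : A ⊗[ℂ] A →ₗ[ℂ] A ⊗[ℂ] A
  /-- Right multiplication with `E`. -/
  rE : A ⊗[ℂ] A →ₗ[ℂ] A ⊗[ℂ] A
  /-- `R₁(a ⊗ b) = ∑ a₍₁₎ ⊗ S(a₍₂₎)b`. -/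
  R₁ : A ⊗[ℂ] A →ₗ[ℂ] A ⊗[ℂ] A
  /-- `R₂(a ⊗ b) = ∑ a S(b₍₁₎) ⊗ b₍₂₎`. -/
  R₂ : A ⊗[ℂ] A →ₗ[ℂ] A ⊗[ℂ] A
  /-- The antipode. -/
  S : A ≃ₗ[ℂ] A
  /-- The counit. -/
  ε : A →ₗ[ℂ] ℂ

namespace CanonicalMaps

variable {A : Type*} [AddCommGroup A] [Module ℂ A] (C : CanonicalMaps A)

/-- Left multiplication with `a`. -/
def L (a : A) : A →ₗ[ℂ] A := C.mul a

/-- Right multiplication with `a`. -/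
def R (a : A) : A →ₗ[ℂ] A := C.mul.flip a

/-- The product as a map on `A ⊗ A`. -/
def mulT : A ⊗[ℂ] A →ₗ[ℂ] A := TensorProduct.lift C.mul

/-- `a ⊗ b ↦ S(a)b`. -/
def SMul : A ⊗[ℂ] A →ₗ[ℂ] A := C.mulT ∘ₗ (C.S.toLinearMap ⊗ₘ id)

/-- `a ⊗ b ↦ aS(b)`. -/
def mulS : A ⊗[ℂ] A →ₗ[ℂ] A := C.mulT ∘ₗ (id ⊗ₘ C.S.toLinearMap)

/-- `a, b ↦ ε_s(a)b`. -/
def es : A →ₗ[ℂ] A →ₗ[ℂ] A := (TensorProduct.mk ℂ A A).compr₂ (C.SMul ∘ₗ C.T₁)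

/-- `a, c ↦ cε_s(a)`. -/
def esr : A →ₗ[ℂ] A →ₗ[ℂ] A := ((TensorProduct.mk ℂ A A).compr₂ (C.mulT ∘ₗ C.R₂)).flip

/-- `a, b ↦ ε_t(a)b`. -/
def et : A →ₗ[ℂ] A →ₗ[ℂ] A := (TensorProduct.mk ℂ A A).compr₂ (C.mulT ∘ₗ C.R₁)

/-- `a, c ↦ cε_t(a)`. -/
def etr : A →ₗ[ℂ] A →ₗ[ℂ] A := ((TensorProduct.mk ℂ A A).compr₂ (C.mulS ∘ₗ C.T₂)).flip

/-- Left multiplication with a slice of the right leg of `E`, that is `c ↦ (f ⊗ ι)(E(b ⊗ c))`. -/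
def rightLeg (f : A →ₗ[ℂ] ℂ) (b : A) : A →ₗ[ℂ] A :=
  fstSlice f ∘ₗ C.lE ∘ₗ TensorProduct.mk ℂ A A b

/-- Right multiplication with a slice of the left leg of `E`, that is `c ↦ (ι ⊗ f)((c ⊗ b)E)`. -/
def leftLeg (f : A →ₗ[ℂ] ℂ) (b : A) : A →ₗ[ℂ] A :=
  sndSlice f ∘ₗ C.rE ∘ₗ (TensorProduct.mk ℂ A A).flip b

@[simp] lemma L_apply (a b : A) : C.L a b = C.mul a b := rfl
@[simp] lemma R_apply (a b : A) : C.R a b = C.mul b a := rfl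
@[simp] lemma mulT_tmul (a b : A) : C.mulT (a ⊗ₜ b) = C.mul a b := by simp [mulT]
@[simp] lemma SMul_tmul (a b : A) : C.SMul (a ⊗ₜ b) = C.mul (C.S a) b := by simp [SMul]
@[simp] lemma mulS_tmul (a b : A) : C.mulS (a ⊗ₜ b) = C.mul a (C.S b) := by simp [mulS]
lemma es_apply (a b : A) : C.es a b = C.SMul (C.T₁ (a ⊗ₜ b)) := rfl
lemma esr_apply (a c : A) : C.esr a c = C.mulT (C.R₂ (c ⊗ₜ a)) := rfl
lemma et_apply (a b : A) : C.et a b = C.mulT (C.R₁ (a ⊗ₜ b)) := rfl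
lemma etr_apply (a c : A) : C.etr a c = C.mulS (C.T₂ (c ⊗ₜ a)) := rfl
lemma rightLeg_apply (f : A →ₗ[ℂ] ℂ) (b c : A) :
    C.rightLeg f b c = fstSlice f (C.lE (b ⊗ₜ c)) := rfl
lemma leftLeg_apply (f : A →ₗ[ℂ] ℂ) (b c : A) :
    C.leftLeg f b c = sndSlice f (C.rE (c ⊗ₜ b)) := rfl

/-- Conjugation of an endomorphism of `A ⊗ A` with the flip. -/
def conj (T : A ⊗[ℂ] A →ₗ[ℂ] A ⊗[ℂ] A) : A ⊗[ℂ] A →ₗ[ℂ] A ⊗[ℂ] A :=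
  (TensorProduct.comm ℂ A A).toLinearMap ∘ₗ T ∘ₗ (TensorProduct.comm ℂ A A).toLinearMap

@[simp] lemma conj_apply (T : A ⊗[ℂ] A →ₗ[ℂ] A ⊗[ℂ] A) (z : A ⊗[ℂ] A) :
    conj T z = TensorProduct.comm ℂ A A (T (TensorProduct.comm ℂ A A z)) := rfl

/-- The data of the opposite algebra with the opposite coproduct. -/
def op : CanonicalMaps A where
  mul := C.mul.flip
  T₁ := conj C.T₂
  T₂ := conj C.T₁
  T₃ := conj C.T₄
  T₄ := conj C.T₃
  lΔ a := conj (C.rΔ a)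
  rΔ a := conj (C.lΔ a)
  lE := conj C.rE
  rE := conj C.lE
  R₁ := conj C.R₂
  R₂ := conj C.R₁
  S := C.S
  ε := C.ε

@[simp] lemma op_mul (a b : A) : C.op.mul a b = C.mul b a := rfl
@[simp] lemma op_T₁ : C.op.T₁ = conj C.T₂ := rfl
@[simp] lemma op_T₂ : C.op.T₂ = conj C.T₁ := rfl
@[simp] lemma op_T₃ : C.op.T₃ = conj C.T₄ := rfl
@[simp] lemma op_T₄ : C.op.T₄ = conj C.T₃ := rfl
@[simp] lemma op_lΔ (a : A) : C.op.lΔ a = conj (C.rΔ a) := rfl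
@[simp] lemma op_rΔ (a : A) : C.op.rΔ a = conj (C.lΔ a) := rfl
@[simp] lemma op_lE : C.op.lE = conj C.rE := rfl
@[simp] lemma op_rE : C.op.rE = conj C.lE := rfl
@[simp] lemma op_R₁ : C.op.R₁ = conj C.R₂ := rfl
@[simp] lemma op_R₂ : C.op.R₂ = conj C.R₁ := rfl
@[simp] lemma op_S : C.op.S = C.S := rfl
@[simp] lemma op_ε : C.op.ε = C.ε := rfl
@[simp] lemma op_L (a : A) : C.op.L a = C.R a := rfl
@[simp] lemma op_R (a : A) : C.op.R a = C.L a := rfl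

@[simp] lemma op_mulT (z : A ⊗[ℂ] A) :
    C.op.mulT (TensorProduct.comm ℂ A A z) = C.mulT z := by
  induction z with
  | zero => simp
  | add x y hx hy => simp only [map_add, hx, hy]
  | tmul p q => simp

@[simp] lemma op_SMul (z : A ⊗[ℂ] A) :
    C.op.SMul (TensorProduct.comm ℂ A A z) = C.mulS z := by
  induction z with
  | zero => simp
  | add x y hx hy => simp only [map_add, hx, hy]
  | tmul p q => simp

@[simp] lemma op_mulS (z : A ⊗[ℂ] A) :
    C.op.mulS (TensorProduct.comm ℂ A A z) = C.SMul z := by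
  induction z with
  | zero => simp
  | add x y hx hy => simp only [map_add, hx, hy]
  | tmul p q => simp

@[simp] lemma op_es : C.op.es = C.etr := by ext; simp [es_apply, etr_apply]
@[simp] lemma op_esr : C.op.esr = C.et := by ext; simp [esr_apply, et_apply]
@[simp] lemma op_et : C.op.et = C.esr := by ext; simp [esr_apply, et_apply]
@[simp] lemma op_etr : C.op.etr = C.es := by ext; simp [es_apply, etr_apply]
@[simp] lemma op_rightLeg (f : A →ₗ[ℂ] ℂ) (b : A) : C.op.rightLeg f b = C.leftLeg f b := by
  ext; simp [rightLeg_apply, leftLeg_apply]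
@[simp] lemma op_leftLeg (f : A →ₗ[ℂ] ℂ) (b : A) : C.op.leftLeg f b = C.rightLeg f b := by
  ext; simp [rightLeg_apply, leftLeg_apply]

/-- The laws of a regular weak multiplier Hopf algebra, in a form that is closed under passing to
the opposite data: every law is accompanied by its opposite, unless it is its own opposite. -/
structure IsWeakHopf : Prop where
  mul_assoc : ∀ a b c, C.mul (C.mul a b) c = C.mul a (C.mul b c)
  left_nondeg : ∀ a, (∀ b, C.mul a b = 0) → a = 0
  right_nondeg : ∀ a, (∀ b, C.mul b a = 0) → a = 0
  /-- The product is idempotent. -/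
  span_mul : Submodule.span ℂ {x | ∃ a b, C.mul a b = x} = ⊤
  /-- `Δ(a)(b ⊗ c)` in terms of `T₁` and of `T₄`. This law and the next four say that the `Tᵢ` come
  from one multiplier `Δ(a)`. -/
  R_T₁ : ∀ a b c, (C.R b ⊗ₘ id) (C.T₁ (a ⊗ₜ c)) = (id ⊗ₘ C.R c) (C.T₄ (b ⊗ₜ a))
  L_T₃ : ∀ a b c, (C.L c ⊗ₘ id) (C.T₃ (a ⊗ₜ b)) = (id ⊗ₘ C.L b) (C.T₂ (c ⊗ₜ a))
  R_T₂ : ∀ a b c, (C.R b ⊗ₘ id) (C.T₂ (c ⊗ₜ a)) = (C.L c ⊗ₘ id) (C.T₄ (b ⊗ₜ a))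
  R_T₃ : ∀ a b c, (id ⊗ₘ C.R b) (C.T₃ (a ⊗ₜ c)) = (id ⊗ₘ C.L c) (C.T₁ (a ⊗ₜ b))
  R_T₂_snd : ∀ a b c, (id ⊗ₘ C.R b) (C.T₂ (c ⊗ₜ a)) = (C.L c ⊗ₘ id) (C.T₁ (a ⊗ₜ b))
  /-- The multiplications with `Δ(a)` are those given by `T₁` and `T₂`; this law and the
  next one. -/
  lΔ_tmul : ∀ a b c, C.lΔ a (b ⊗ₜ c) = (C.R b ⊗ₘ id) (C.T₁ (a ⊗ₜ c))
  rΔ_tmul : ∀ a b c, C.rΔ a (b ⊗ₜ c) = (id ⊗ₘ C.L c) (C.T₂ (b ⊗ₜ a))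
  /-- The coproduct is multiplicative; this law and the next one. -/
  T₁_mul : ∀ a b c, C.T₁ (C.mul a b ⊗ₜ c) = C.lΔ a (C.T₁ (b ⊗ₜ c))
  T₂_mul : ∀ a b c, C.T₂ (c ⊗ₜ C.mul a b) = C.rΔ b (C.T₂ (c ⊗ₜ a))
  /-- `lE` and `rE` form a multiplier of `A ⊗ A`; this law and the next two. -/
  lE_R : ∀ b c z, C.lE ((C.R b ⊗ₘ C.R c) z) = (C.R b ⊗ₘ C.R c) (C.lE z)
  rE_L : ∀ b c z, C.rE ((C.L b ⊗ₘ C.L c) z) = (C.L b ⊗ₘ C.L c) (C.rE z)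
  L_lE : ∀ a b c d, (C.L a ⊗ₘ C.L b) (C.lE (c ⊗ₜ d)) = (C.R c ⊗ₘ C.R d) (C.rE (a ⊗ₜ b))
  /-- `R₁` is a generalized inverse of `T₁`, and `R₂` is one of `T₂`, with range projection
  `E`; this law and the next five. -/
  T₁_R₁ : ∀ z, C.T₁ (C.R₁ z) = C.lE z
  T₂_R₂ : ∀ z, C.T₂ (C.R₂ z) = C.rE z
  R₁_lE : ∀ z, C.R₁ (C.lE z) = C.R₁ z
  R₂_rE : ∀ z, C.R₂ (C.rE z) = C.R₂ z
  lE_T₁ : ∀ z, C.lE (C.T₁ z) = C.T₁ z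
  rE_T₂ : ∀ z, C.rE (C.T₂ z) = C.T₂ z
  /-- `(ε ⊗ ι)(Δ(a)(1 ⊗ b)) = ab`, and the opposite of this law. -/
  counit_T₁ : ∀ z, fstSlice C.ε (C.T₁ z) = C.mulT z
  counit_T₂ : ∀ z, sndSlice C.ε (C.T₂ z) = C.mulT z
  /-- `R₁` in terms of the antipode, covered from the left in the first factor. -/
  L_R₁ : ∀ a b c, (C.L c ⊗ₘ id) (C.R₁ (a ⊗ₜ b)) =
    (id ⊗ₘ (C.R b ∘ₗ C.S.toLinearMap)) (C.T₂ (c ⊗ₜ a))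
  /-- `R₂` in terms of the antipode, covered from the right in the second factor. -/
  R_R₂ : ∀ a b c, (id ⊗ₘ C.R c) (C.R₂ (a ⊗ₜ b)) =
    ((C.L a ∘ₗ C.S.toLinearMap) ⊗ₘ id) (C.T₁ (b ⊗ₜ c))
  /-- `∑ ε_s(a₍₁₎)b ⊗ a₍₂₎c = (1 ⊗ a)E(b ⊗ c)`. -/
  es_T₁ : ∀ a b c, (C.es.flip b ⊗ₘ id) (C.T₁ (a ⊗ₜ c)) = (id ⊗ₘ C.L a) (C.lE (b ⊗ₜ c))
  /-- `∑ ca₍₁₎ ⊗ bε_t(a₍₂₎) = (c ⊗ b)E(a ⊗ 1)`. -/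
  etr_T₂ : ∀ a b c, (id ⊗ₘ C.etr.flip b) (C.T₂ (c ⊗ₜ a)) = (C.R a ⊗ₘ id) (C.rE (c ⊗ₜ b))
  /-- `Δ(yz) = (y ⊗ 1)Δ(z)` for `y` in the right leg of `E`. -/
  T₁_rightLeg : ∀ f b z, C.T₁ ((C.rightLeg f b ⊗ₘ id) z) = (C.rightLeg f b ⊗ₘ id) (C.T₁ z)
  /-- `Δ(zy) = Δ(z)(1 ⊗ y)` for `y` in the left leg of `E`. -/
  T₂_leftLeg : ∀ f b z, C.T₂ ((id ⊗ₘ C.leftLeg f b) z) = (id ⊗ₘ C.leftLeg f b) (C.T₂ z)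
  /-- `E(y ⊗ 1) = (y ⊗ 1)E` for `y` in the right leg of `E`. -/
  lE_rightLeg : ∀ f b z, C.lE ((C.rightLeg f b ⊗ₘ id) z) = (C.rightLeg f b ⊗ₘ id) (C.lE z)
  /-- `E(1 ⊗ y) = (1 ⊗ y)E` for `y` in the left leg of `E`. -/
  rE_leftLeg : ∀ f b z, C.rE ((id ⊗ₘ C.leftLeg f b) z) = (id ⊗ₘ C.leftLeg f b) (C.rE z)
  /-- `R₂T₂(p ⊗ q)(1 ⊗ c) = ∑ pε_t(q₍₁₎) ⊗ q₍₂₎c`. -/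
  R_R₂_T₂ : ∀ p q c, (id ⊗ₘ C.R c) (C.R₂ (C.T₂ (p ⊗ₜ q))) =
    (C.etr.flip p ⊗ₘ id) (C.T₁ (q ⊗ₜ c))
  /-- `(c ⊗ 1)R₁T₁(q ⊗ p) = ∑ cq₍₁₎ ⊗ ε_s(q₍₂₎)p`. -/
  L_R₁_T₁ : ∀ p q c, (C.L c ⊗ₘ id) (C.R₁ (C.T₁ (q ⊗ₜ p))) =
    (id ⊗ₘ C.es.flip p) (C.T₂ (c ⊗ₜ q))
  /-- The legs of the coproduct are all of `A`; this law and the next one. -/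
  full_left : Submodule.span ℂ {x | ∃ z f, sndSlice f (C.T₁ z) = x} = ⊤
  full_right : Submodule.span ℂ {x | ∃ z f, fstSlice f (C.T₂ z) = x} = ⊤

variable {C}

theorem IsWeakHopf.op (h : C.IsWeakHopf) : C.op.IsWeakHopf where
  mul_assoc a b c := (h.mul_assoc c b a).symm
  left_nondeg := h.right_nondeg
  right_nondeg := h.left_nondeg
  span_mul := by
    rw [← h.span_mul]; congr 1; ext x; exact exists_comm
  R_T₁ a b c := by simp [TensorProduct.map_comm, h.L_T₃]
  L_T₃ a b c := by simp [TensorProduct.map_comm, h.R_T₁]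
  R_T₂ a b c := by simp [TensorProduct.map_comm, h.R_T₃]
  R_T₃ a b c := by simp [TensorProduct.map_comm, h.R_T₂]
  R_T₂_snd a b c := by simp [TensorProduct.map_comm, h.R_T₂_snd]
  lΔ_tmul a b c := by simp [TensorProduct.map_comm, h.rΔ_tmul]
  rΔ_tmul a b c := by simp [TensorProduct.map_comm, h.lΔ_tmul]
  T₁_mul a b c := by simp [h.T₂_mul]
  T₂_mul a b c := by simp [h.T₁_mul]
  lE_R b c z := by
    obtain ⟨z, rfl⟩ := (TensorProduct.comm ℂ A A).surjective z
    simp [TensorProduct.map_comm, h.rE_L]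
  rE_L b c z := by
    obtain ⟨z, rfl⟩ := (TensorProduct.comm ℂ A A).surjective z
    simp [TensorProduct.map_comm, h.lE_R]
  L_lE a b c d := by simp [TensorProduct.map_comm, h.L_lE]
  T₁_R₁ z := by simp [h.T₂_R₂]
  T₂_R₂ z := by simp [h.T₁_R₁]
  R₁_lE z := by simp [h.R₂_rE]
  R₂_rE z := by simp [h.R₁_lE]
  lE_T₁ z := by simp [h.rE_T₂]
  rE_T₂ z := by simp [h.lE_T₁]
  counit_T₁ z := by
    obtain ⟨z, rfl⟩ := (TensorProduct.comm ℂ A A).surjective z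
    simp [h.counit_T₂]
  counit_T₂ z := by
    obtain ⟨z, rfl⟩ := (TensorProduct.comm ℂ A A).surjective z
    simp [h.counit_T₁]
  L_R₁ a b c := by simp [TensorProduct.map_comm, h.R_R₂]
  R_R₂ a b c := by simp [TensorProduct.map_comm, h.L_R₁]
  es_T₁ a b c := by simp [TensorProduct.map_comm, h.etr_T₂]
  etr_T₂ a b c := by simp [TensorProduct.map_comm, h.es_T₁]
  T₁_rightLeg f b z := by
    obtain ⟨z, rfl⟩ := (TensorProduct.comm ℂ A A).surjective z
    simp [TensorProduct.map_comm, h.T₂_leftLeg]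
  T₂_leftLeg f b z := by
    obtain ⟨z, rfl⟩ := (TensorProduct.comm ℂ A A).surjective z
    simp [TensorProduct.map_comm, h.T₁_rightLeg]
  lE_rightLeg f b z := by
    obtain ⟨z, rfl⟩ := (TensorProduct.comm ℂ A A).surjective z
    simp [TensorProduct.map_comm, h.rE_leftLeg]
  rE_leftLeg f b z := by
    obtain ⟨z, rfl⟩ := (TensorProduct.comm ℂ A A).surjective z
    simp [TensorProduct.map_comm, h.lE_rightLeg]
  R_R₂_T₂ p q c := by simp [TensorProduct.map_comm, h.L_R₁_T₁]
  L_R₁_T₁ p q c := by simp [TensorProduct.map_comm, h.R_R₂_T₂]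
  full_left := by
    rw [← h.full_right]; congr 1; ext x
    exact ⟨fun ⟨z, f, hz⟩ => ⟨TensorProduct.comm ℂ A A z, f, by simpa using hz⟩,
      fun ⟨z, f, hz⟩ => ⟨TensorProduct.comm ℂ A A z, f, by simpa using hz⟩⟩
  full_right := by
    rw [← h.full_left]; congr 1; ext x
    exact ⟨fun ⟨z, f, hz⟩ => ⟨TensorProduct.comm ℂ A A z, f, by simpa using hz⟩,
      fun ⟨z, f, hz⟩ => ⟨TensorProduct.comm ℂ A A z, f, by simpa using hz⟩⟩

namespace IsWeakHopf

/-! ### Non-degeneracy and multipliers -/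

lemma ext_L {x y : A} (h : C.IsWeakHopf) (hxy : ∀ c, C.mul c x = C.mul c y) : x = y :=
  sub_eq_zero.1 (h.right_nondeg _ fun c => by rw [map_sub, hxy, sub_self])

lemma ext_R {x y : A} (h : C.IsWeakHopf) (hxy : ∀ c, C.mul x c = C.mul y c) : x = y :=
  h.op.ext_L hxy

lemma ext_R_fst (h : C.IsWeakHopf) {z w : A ⊗[ℂ] A}
    (hzw : ∀ b, (C.R b ⊗ₘ id) z = (C.R b ⊗ₘ id) w) : z = w :=
  ext_map_fst h.left_nondeg hzw

lemma ext_R_snd (h : C.IsWeakHopf) {z w : A ⊗[ℂ] A}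
    (hzw : ∀ b, (id ⊗ₘ C.R b) z = (id ⊗ₘ C.R b) w) : z = w :=
  ext_map_snd h.left_nondeg hzw

lemma ext_L_fst (h : C.IsWeakHopf) {z w : A ⊗[ℂ] A}
    (hzw : ∀ b, (C.L b ⊗ₘ id) z = (C.L b ⊗ₘ id) w) : z = w :=
  ext_map_fst h.right_nondeg hzw

lemma ext_L_snd (h : C.IsWeakHopf) {z w : A ⊗[ℂ] A}
    (hzw : ∀ b, (id ⊗ₘ C.L b) z = (id ⊗ₘ C.L b) w) : z = w :=
  ext_map_snd h.right_nondeg hzw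

lemma ext_L_L (h : C.IsWeakHopf) {z w : A ⊗[ℂ] A}
    (hzw : ∀ a b, (C.L a ⊗ₘ C.L b) z = (C.L a ⊗ₘ C.L b) w) : z = w :=
  h.ext_L_fst fun a => h.ext_L_snd fun b => by
    simpa only [map_map, id_comp, comp_id] using hzw a b

lemma ext_R_R (h : C.IsWeakHopf) {z w : A ⊗[ℂ] A}
    (hzw : ∀ a b, (C.R a ⊗ₘ C.R b) z = (C.R a ⊗ₘ C.R b) w) : z = w :=
  h.ext_R_fst fun a => h.ext_R_snd fun b => by
    simpa only [map_map, id_comp, comp_id] using hzw a b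

lemma L_comp_R (h : C.IsWeakHopf) (a b : A) : C.L a ∘ₗ C.R b = C.R b ∘ₗ C.L a := by
  ext c; simp [h.mul_assoc]

lemma L_mul (h : C.IsWeakHopf) (a b : A) : C.L (C.mul a b) = C.L a ∘ₗ C.L b := by
  ext c; simp [h.mul_assoc]

lemma R_mul (h : C.IsWeakHopf) (a b : A) : C.R (C.mul a b) = C.R b ∘ₗ C.R a := by
  ext c; simp [h.mul_assoc]

lemma mulT_L (h : C.IsWeakHopf) (c : A) (z : A ⊗[ℂ] A) :
    C.mulT ((C.L c ⊗ₘ id) z) = C.mul c (C.mulT z) := by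
  induction z with
  | zero => simp
  | add x y hx hy => simp only [map_add, hx, hy]
  | tmul p q => simp [h.mul_assoc]

lemma mulT_R (h : C.IsWeakHopf) (c : A) (z : A ⊗[ℂ] A) :
    C.mulT ((id ⊗ₘ C.R c) z) = C.mul (C.mulT z) c := by
  induction z with
  | zero => simp
  | add x y hx hy => simp only [map_add, hx, hy, LinearMap.add_apply]
  | tmul p q => simp [h.mul_assoc]

/-- `c ↦ cε_t(a)` and `b ↦ ε_t(a)b` form a multiplier. -/
lemma mul_et (h : C.IsWeakHopf) (a b c : A) : C.mul c (C.et a b) = C.mul (C.etr a c) b := by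
  have h1 := congrArg C.mulT (h.L_R₁ a b c)
  rw [h.mulT_L] at h1
  rw [et_apply, h1, etr_apply, mulS, comp_apply, ← h.mulT_R, map_map, id_comp]

lemma mul_es (h : C.IsWeakHopf) (a b c : A) : C.mul c (C.es a b) = C.mul (C.esr a c) b := by
  simpa using (h.op.mul_et a c b).symm

lemma es_mul (h : C.IsWeakHopf) (a b c : A) : C.es a (C.mul b c) = C.mul (C.es a b) c :=
  h.ext_L fun d => by rw [h.mul_es, ← h.mul_assoc, ← h.mul_es, h.mul_assoc]

lemma etr_mul (h : C.IsWeakHopf) (a b c : A) : C.etr a (C.mul b c) = C.mul b (C.etr a c) := by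
  simpa using h.op.es_mul a c b

lemma es_etr (h : C.IsWeakHopf) (a b c : A) : C.es a (C.etr b c) = C.etr b (C.es a c) :=
  h.ext_L fun d => h.ext_R fun e => by
    rw [h.mul_es, h.mul_assoc, ← h.mul_et, h.mul_assoc, ← h.mul_et, ← h.mul_assoc, ← h.mul_assoc,
      h.mul_es]

/-! ### The canonical idempotent and the coproduct as multipliers -/

lemma lE_R_fst (h : C.IsWeakHopf) (b : A) (z : A ⊗[ℂ] A) :
    C.lE ((C.R b ⊗ₘ id) z) = (C.R b ⊗ₘ id) (C.lE z) :=
  h.ext_R_R fun c d => by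
    rw [← h.lE_R, map_map, map_map, comp_id, ← h.R_mul, h.lE_R]

lemma lE_R_snd (h : C.IsWeakHopf) (b : A) (z : A ⊗[ℂ] A) :
    C.lE ((id ⊗ₘ C.R b) z) = (id ⊗ₘ C.R b) (C.lE z) :=
  h.ext_R_R fun c d => by
    rw [← h.lE_R, map_map, map_map, comp_id, ← h.R_mul, h.lE_R]

lemma rE_L_snd (h : C.IsWeakHopf) (b : A) (z : A ⊗[ℂ] A) :
    C.rE ((id ⊗ₘ C.L b) z) = (id ⊗ₘ C.L b) (C.rE z) :=
  h.ext_L_L fun c d => by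
    rw [← h.rE_L, map_map, map_map, comp_id, ← h.L_mul, h.rE_L]

lemma rE_rΔ (h : C.IsWeakHopf) (a : A) (z : A ⊗[ℂ] A) : C.rE (C.rΔ a z) = C.rΔ a z := by
  induction z with
  | zero => simp
  | add x y hx hy => simp only [map_add, hx, hy]
  | tmul p q => rw [h.rΔ_tmul, h.rE_L_snd, h.rE_T₂]

/-- The product of `A ⊗ A`. -/
def _root_.WMHA.CanonicalMaps.mul₂ (C : CanonicalMaps A) :
    A ⊗[ℂ] A →ₗ[ℂ] A ⊗[ℂ] A →ₗ[ℂ] A ⊗[ℂ] A :=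
  TensorProduct.map₂ C.mul C.mul

lemma tmul_mul₂ (a b : A) (w : A ⊗[ℂ] A) : C.mul₂ (a ⊗ₜ b) w = (C.L a ⊗ₘ C.L b) w := by
  induction w with
  | zero => simp
  | add x y hx hy => simp only [map_add, hx, hy]
  | tmul p q => simp [mul₂]

lemma mul₂_tmul (a b : A) (w : A ⊗[ℂ] A) : C.mul₂ w (a ⊗ₜ b) = (C.R a ⊗ₘ C.R b) w := by
  induction w with
  | zero => simp
  | add x y hx hy => simp only [map_add, hx, hy, LinearMap.add_apply]
  | tmul p q => simp [mul₂]

lemma mul₂_lE (h : C.IsWeakHopf) (z w : A ⊗[ℂ] A) : C.mul₂ z (C.lE w) = C.mul₂ (C.rE z) w := by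
  induction z with
  | zero => simp
  | add x y hx hy => simp only [map_add, hx, hy, LinearMap.add_apply]
  | tmul a b =>
    induction w with
    | zero => simp
    | add x y hx hy => simp only [map_add, hx, hy]
    | tmul c d => rw [tmul_mul₂, mul₂_tmul, h.L_lE]

lemma mul₂_lΔ (h : C.IsWeakHopf) (x : A) (z w : A ⊗[ℂ] A) :
    C.mul₂ z (C.lΔ x w) = C.mul₂ (C.rΔ x z) w := by
  induction z with
  | zero => simp
  | add x y hx hy => simp only [map_add, hx, hy, LinearMap.add_apply]
  | tmul a b =>
    induction w with
    | zero => simp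
    | add x y hx hy => simp only [map_add, hx, hy]
    | tmul c d =>
      have h1 := congrArg (C.R c ⊗ₘ C.L b) (h.R_T₂_snd x d a)
      rw [map_map, map_map] at h1
      rw [tmul_mul₂, mul₂_tmul, h.lΔ_tmul, h.rΔ_tmul, map_map, map_map, h.L_comp_R]
      simp only [comp_id] at h1 ⊢
      rw [← h1, h.L_comp_R]

lemma lΔ_lE (h : C.IsWeakHopf) (a : A) (z : A ⊗[ℂ] A) : C.lΔ a (C.lE z) = C.lΔ a z :=
  h.ext_L_L fun c d => by
    rw [← tmul_mul₂, h.mul₂_lΔ, h.mul₂_lE, h.rE_rΔ, ← h.mul₂_lΔ, tmul_mul₂]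

lemma rΔ_rE (h : C.IsWeakHopf) (a : A) (z : A ⊗[ℂ] A) : C.rΔ a (C.rE z) = C.rΔ a z := by
  obtain ⟨z, rfl⟩ := (TensorProduct.comm ℂ A A).surjective z
  simpa using h.op.lΔ_lE a z

/-! ### The source and target maps -/

lemma et_eq_rightLeg (h : C.IsWeakHopf) (a : A) : C.et a = C.rightLeg C.ε a := by
  ext b; rw [et_apply, rightLeg_apply, ← h.T₁_R₁, h.counit_T₁]

lemma esr_eq_leftLeg (h : C.IsWeakHopf) (a : A) : C.esr a = C.leftLeg C.ε a := by
  simpa using h.op.et_eq_rightLeg a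

lemma lE_es (h : C.IsWeakHopf) (a : A) (z : A ⊗[ℂ] A) :
    C.lE ((id ⊗ₘ C.es a) z) = (id ⊗ₘ C.es a) (C.lE z) := by
  have hR : ∀ d, C.R (C.es a d) = C.R d ∘ₗ C.esr a := fun d => by ext b; simp [h.mul_es]
  have hL : ∀ d, C.L (C.esr a d) = C.L d ∘ₗ C.es a := fun d => by ext b; simp [h.mul_es]
  induction z with
  | zero => simp
  | add x y hx hy => simp only [map_add, hx, hy]
  | tmul p q =>
    refine h.ext_L_L fun c d => ?_
    have h1 := h.rE_leftLeg C.ε a (c ⊗ₜ d)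
    rw [← h.esr_eq_leftLeg, map_tmul, id_apply] at h1
    rw [map_tmul, id_apply, h.L_lE, hR, ← comp_id (C.R p), ← map_map, ← h1, ← h.L_lE, hL,
      map_map, comp_id]

/-- `Δ(xε_t(a)) = Δ(x)(ε_t(a) ⊗ 1)`. -/
lemma lΔ_etr (h : C.IsWeakHopf) (a x : A) (z : A ⊗[ℂ] A) :
    C.lΔ (C.etr a x) z = C.lΔ x ((C.et a ⊗ₘ id) z) := by
  have h1 : ∀ w, C.lΔ (C.etr a x) (C.T₁ w) = C.lΔ x ((C.et a ⊗ₘ id) (C.T₁ w)) := by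
    intro w
    induction w with
    | zero => simp
    | add x y hx hy => simp only [map_add, hx, hy]
    | tmul p q =>
      rw [← h.T₁_mul, ← h.mul_et, h.T₁_mul, h.et_eq_rightLeg, ← h.T₁_rightLeg, map_tmul,
        id_apply]
  have h2 := h1 (C.R₁ z)
  rw [h.T₁_R₁, h.lΔ_lE, h.et_eq_rightLeg, ← h.lE_rightLeg, h.lΔ_lE] at h2
  rw [h2, h.et_eq_rightLeg]

lemma R_R_T₂ (h : C.IsWeakHopf) (b c d x : A) :
    (C.R b ⊗ₘ C.R c) (C.T₂ (d ⊗ₜ x)) = (C.L d ⊗ₘ id) (C.lΔ x (b ⊗ₜ c)) := by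
  have h1 := congrArg (C.R b ⊗ₘ id) (h.R_T₂_snd x c d)
  rw [map_map, map_map, comp_id, id_comp, ← h.L_comp_R] at h1
  rw [h.lΔ_tmul, map_map, h1, comp_id]

lemma T₂_etr (h : C.IsWeakHopf) (a d x : A) :
    C.T₂ (d ⊗ₜ C.etr a x) = (C.etr a ⊗ₘ id) (C.T₂ (d ⊗ₜ x)) :=
  h.ext_R_R fun b c => by
    have hR : C.R (C.et a b) = C.R b ∘ₗ C.etr a := by ext d; simp [h.mul_et]
    rw [h.R_R_T₂, h.lΔ_etr, map_tmul, id_apply, ← h.R_R_T₂, hR, map_map, comp_id]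

lemma T₁_es (h : C.IsWeakHopf) (a x c : A) :
    C.T₁ (C.es a x ⊗ₜ c) = (id ⊗ₘ C.es a) (C.T₁ (x ⊗ₜ c)) := by
  simpa [TensorProduct.map_comm] using h.op.T₂_etr a c x

lemma T₂_es (h : C.IsWeakHopf) (a d x : A) :
    C.T₂ (d ⊗ₜ C.es a x) = (id ⊗ₘ C.es a) (C.T₂ (d ⊗ₜ x)) :=
  h.ext_R_snd fun c => by
    have hR : C.R c ∘ₗ C.es a = C.es a ∘ₗ C.R c := by ext d; simp [h.es_mul]
    have h1 := congrArg (id ⊗ₘ C.es a) (h.R_T₂_snd x c d)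
    simp only [map_map, id_comp, comp_id] at h1
    simp only [h.R_T₂_snd, h.T₁_es, map_map, id_comp, comp_id, hR, h1]

lemma T₁_etr (h : C.IsWeakHopf) (a x c : A) :
    C.T₁ (C.etr a x ⊗ₜ c) = (C.etr a ⊗ₘ id) (C.T₁ (x ⊗ₜ c)) := by
  simpa [TensorProduct.map_comm] using h.op.T₂_es a c x

lemma lE_fstSlice_T₂ (h : C.IsWeakHopf) (f : A →ₗ[ℂ] ℂ) (c : A) (z : A ⊗[ℂ] A) :
    C.lE (((fstSlice f ∘ₗ C.T₂ ∘ₗ TensorProduct.mk ℂ A A c) ⊗ₘ id) z) =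
      ((fstSlice f ∘ₗ C.T₂ ∘ₗ TensorProduct.mk ℂ A A c) ⊗ₘ id) (C.lE z) := by
  set t := fstSlice f ∘ₗ C.T₂ ∘ₗ TensorProduct.mk ℂ A A c with ht
  have hcomm : ∀ b, t ∘ₗ C.es.flip b = C.es.flip (t b) := by
    intro b; ext a
    simp only [ht, comp_apply, flip_apply, mk_apply]
    rw [h.T₂_es, fstSlice_map, comp_id]
  induction z with
  | zero => simp
  | add x y hx hy => simp only [map_add, hx, hy]
  | tmul p q =>
    refine h.ext_L_snd fun x => ?_
    rw [map_tmul, id_apply, ← h.es_T₁, ← hcomm, map_map, id_comp, comp_id, ← comp_id t,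
      ← id_comp (C.L x), ← map_map, ← h.es_T₁, map_map, id_comp]
    simp

/-- `S(a)b = ∑ S(E₍₁₎a)E₍₂₎b`. This follows from `R₁ = R₁E`, since the maps
`x ↦ (f ⊗ ι)((c ⊗ 1)Δ(x))` commute with left multiplication by the left leg of `E` and have
values that span `A`. -/
lemma SMul_lE (h : C.IsWeakHopf) (z : A ⊗[ℂ] A) : C.SMul (C.lE z) = C.SMul z := by
  have key : ∀ (f : A →ₗ[ℂ] ℂ) (c : A) (w : A ⊗[ℂ] A),
      fstSlice (f ∘ₗ C.L c) (C.R₁ w) =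
        C.SMul (((fstSlice f ∘ₗ C.T₂ ∘ₗ TensorProduct.mk ℂ A A c) ⊗ₘ id) w) := by
    intro f c w
    induction w with
    | zero => simp
    | add x y hx hy => simp only [map_add, hx, hy]
    | tmul a b =>
      have h1 := congrArg (fstSlice f) (h.L_R₁ a b c)
      rw [fstSlice_map, fstSlice_map] at h1
      simpa using h1
  induction z with
  | zero => simp
  | add x y hx hy => simp only [map_add, hx, hy]
  | tmul a b =>
    suffices C.SMul ∘ₗ C.lE ∘ₗ (TensorProduct.mk ℂ A A).flip b =
      C.SMul ∘ₗ (TensorProduct.mk ℂ A A).flip b from LinearMap.congr_fun this a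
    refine LinearMap.ext_on h.full_right ?_
    rintro _ ⟨z, f, rfl⟩
    induction z with
    | zero => simp
    | add x y hx hy =>
      rw [map_add, map_add, map_add, map_add, hx, hy]
    | tmul c a =>
      have h1 := key f c (C.lE (a ⊗ₜ b))
      rw [h.R₁_lE, key, ← h.lE_fstSlice_T₂] at h1
      simpa using h1.symm

/-! ### The antipode reverses products -/

/-- `(ι ⊗ ε)((u ⊗ a)Δ(v)) = uε_s(a)v`. -/
lemma sndSlice_T₂ (h : C.IsWeakHopf) (a : A) (z : A ⊗[ℂ] A) :
    sndSlice (C.ε ∘ₗ C.L a) (C.T₂ z) = C.mulT ((C.esr a ⊗ₘ id) z) := by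
  induction z with
  | zero => simp
  | add x y hx hy => simp only [map_add, hx, hy]
  | tmul u v =>
    have key : ∀ w, sndSlice C.ε (C.rΔ v (C.T₂ w)) = C.mul (C.mulT w) v := by
      intro w
      induction w with
      | zero => simp
      | add x y hx hy => simp only [map_add, hx, hy, LinearMap.add_apply]
      | tmul p q => rw [← h.T₂_mul, h.counit_T₂]; simp [h.mul_assoc]
    have h1 := h.rΔ_tmul v u a
    rw [← h.rΔ_rE, ← h.T₂_R₂] at h1
    have h2 := congrArg (sndSlice C.ε) h1
    rw [key, sndSlice_map] at h2
    simpa [esr_apply] using h2.symm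

lemma esr_of_mul (h : C.IsWeakHopf) (a b c : A) :
    C.esr (C.mul a b) c = C.mulT ((C.esr a ⊗ₘ id) (C.R₂ (c ⊗ₜ b))) := by
  have h1 := h.rE_L_snd a (c ⊗ₜ b)
  rw [map_tmul, id_apply, L_apply] at h1
  rw [h.esr_eq_leftLeg, leftLeg_apply, h1, sndSlice_map, ← h.sndSlice_T₂, h.T₂_R₂, id_apply]

lemma et_of_mul (h : C.IsWeakHopf) (a b c : A) :
    C.et (C.mul a b) c = C.mulT ((id ⊗ₘ C.et b) (C.R₁ (a ⊗ₜ c))) := by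
  simpa [TensorProduct.map_comm] using h.op.esr_of_mul b a c

lemma mulT_esr (h : C.IsWeakHopf) (a : A) (z : A ⊗[ℂ] A) :
    C.mulT ((C.esr a ⊗ₘ id) z) = C.mulT ((id ⊗ₘ C.es a) z) := by
  induction z with
  | zero => simp
  | add x y hx hy => simp only [map_add, hx, hy]
  | tmul u v => simp [h.mul_es]

lemma mulT_etr (h : C.IsWeakHopf) (a : A) (z : A ⊗[ℂ] A) :
    C.mulT ((C.etr a ⊗ₘ id) z) = C.mulT ((id ⊗ₘ C.et a) z) := by
  induction z with
  | zero => simp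
  | add x y hx hy => simp only [map_add, hx, hy]
  | tmul u v => simp [h.mul_et]

/-- `ε_s(ab)c = ∑ S(b₍₁₎)ε_s(a)b₍₂₎c`. -/
lemma es_of_mul (h : C.IsWeakHopf) (a b c : A) :
    C.es (C.mul a b) c = C.SMul ((id ⊗ₘ C.es a) (C.T₁ (b ⊗ₜ c))) :=
  h.ext_L fun d => by
    rw [h.mul_es, h.esr_of_mul, ← h.mulT_R, map_map, id_comp, comp_id, ← comp_id (C.esr a),
      ← id_comp (C.R c), ← map_map, h.R_R₂, h.mulT_esr, SMul, comp_apply,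
      ← h.mulT_L]
    simp only [map_map, comp_id, id_comp]

/-- The antipode reverses products: with `∑ u ⊗ v = ∑ a₍₁₎ ⊗ S(a₍₂₎)c` one has
`S(ab)c = ∑ ε_s(u b₍₁₎)S(b₍₂₎)v = ∑ S(b)ε_s(u)v = S(b)S(a)c`. -/
theorem S_mul (h : C.IsWeakHopf) (a b : A) : C.S (C.mul a b) = C.mul (C.S b) (C.S a) := by
  have h1 : ∀ u w, C.SMul (C.lΔ u (C.T₁ w)) = C.SMul ((id ⊗ₘ C.es u) (C.T₁ w)) := by
    intro u w
    induction w with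
    | zero => simp
    | add x y hx hy => simp only [map_add, hx, hy]
    | tmul p q => rw [← h.T₁_mul, ← es_apply, h.es_of_mul]
  have h2 : ∀ z, C.SMul ((C.R b ⊗ₘ id) (C.T₁ z)) = C.mul (C.S b) (C.SMul (C.T₁ z)) := by
    intro z
    induction z with
    | zero => simp
    | add x y hx hy => simp only [map_add, hx, hy]
    | tmul u v =>
      rw [← h.lΔ_tmul, ← h.lΔ_lE, ← h.T₁_R₁, h1, h.T₁_R₁, ← h.lE_es, h.SMul_lE]
      simp [es_apply]
  refine h.ext_R fun c => ?_
  have h3 := h2 (C.R₁ (a ⊗ₜ c))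
  rw [h.T₁_R₁, ← h.lE_R_fst, h.SMul_lE, h.SMul_lE] at h3
  simpa [h.mul_assoc] using h3

/-! ### The counit and the antipode -/

lemma R₁_etr (h : C.IsWeakHopf) (a b c : A) :
    C.R₁ (C.etr a b ⊗ₜ c) = (C.etr a ⊗ₘ id) (C.R₁ (b ⊗ₜ c)) :=
  h.ext_L_fst fun d => by
    have hL : C.L d ∘ₗ C.etr a = C.etr a ∘ₗ C.L d := by ext x; simp [h.etr_mul]
    have h1 := congrArg (C.etr a ⊗ₘ id) (h.L_R₁ b c d)
    simp only [map_map, id_comp] at h1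
    simp only [h.L_R₁, h.T₂_etr, map_map, hL, id_comp, comp_id, h1]

/-- `ε_t(aε_t(b)) = ε_t(ab)`. -/
lemma et_etr (h : C.IsWeakHopf) (a b c : A) : C.et (C.etr b a) c = C.et (C.mul a b) c := by
  rw [et_apply, h.R₁_etr, h.mulT_etr, h.et_of_mul]

lemma sndSlice_es (h : C.IsWeakHopf) (f : A →ₗ[ℂ] ℂ) (a b c : A) :
    C.es (sndSlice f (C.T₁ (a ⊗ₜ c))) b = sndSlice (f ∘ₗ C.L a) (C.lE (b ⊗ₜ c)) := by
  have h1 := congrArg (sndSlice f) (h.es_T₁ a b c)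
  rw [sndSlice_map, sndSlice_map, comp_id] at h1
  exact h1

/-- `ε_s(A)A = A`. -/
lemma span_es (h : C.IsWeakHopf) : Submodule.span ℂ {x | ∃ a b, C.es a b = x} = ⊤ := by
  by_contra hne
  obtain ⟨f, hf, hle⟩ := Submodule.exists_le_ker_of_lt_top _ (lt_top_iff_ne_top.2 hne)
  have hes : ∀ a b, f (C.es a b) = 0 := fun a b => hle (Submodule.subset_span ⟨a, b, rfl⟩)
  have hE : ∀ z, fstSlice f (C.lE z) = 0 := by
    intro z
    induction z with
    | zero => simp
    | add x y hx hy => rw [map_add, map_add, hx, hy, add_zero]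
    | tmul b c =>
      refine h.right_nondeg _ fun a => ?_
      have h1 := congrArg (fstSlice f) (h.es_T₁ a b c)
      rw [fstSlice_map, fstSlice_map] at h1
      have h2 : f ∘ₗ C.es.flip b = 0 := by ext x; exact hes x b
      rw [h2] at h1
      simpa [fstSlice] using h1.symm
  refine hf (LinearMap.ext_on h.full_left ?_)
  rintro _ ⟨z, g, rfl⟩
  rw [← apply_fstSlice_eq, ← h.lE_T₁, hE, map_zero, LinearMap.zero_apply]

lemma span_etr (h : C.IsWeakHopf) : Submodule.span ℂ {x | ∃ a b, C.etr a b = x} = ⊤ := by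
  simpa using h.op.span_es

lemma counit_es_eq_zero (h : C.IsWeakHopf) {b : A} (hb : C.et b = 0) (a : A) :
    C.ε (C.es a b) = 0 := by
  suffices C.ε ∘ₗ C.es.flip b = 0 from LinearMap.congr_fun this a
  refine LinearMap.ext_on h.full_left ?_
  rintro _ ⟨z, f, rfl⟩
  induction z with
  | zero => simp
  | add x y hx hy => rw [map_add, map_add, map_add, map_add, hx, hy]
  | tmul a c =>
    have h1 : fstSlice C.ε (C.lE (b ⊗ₜ c)) = 0 := by
      rw [← C.rightLeg_apply, ← h.et_eq_rightLeg, hb, LinearMap.zero_apply]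
    rw [comp_apply, flip_apply, h.sndSlice_es, ← apply_fstSlice_eq, h1, map_zero,
      LinearMap.zero_apply]

/-- `ε(aε_t(b)) = ε(ab)`. For `a = ε_s(r)c` the difference of the arguments is `ε_s(r)d` with
`d = cε_t(b) - cb`, and `ε_t(d) = 0`. -/
lemma counit_etr (h : C.IsWeakHopf) (a b : A) : C.ε (C.etr b a) = C.ε (C.mul a b) := by
  suffices C.ε ∘ₗ C.etr b = C.ε ∘ₗ C.R b from LinearMap.congr_fun this a
  refine LinearMap.ext_on h.span_es ?_
  rintro _ ⟨r, c, rfl⟩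
  have h1 : C.et (C.etr b c - C.mul c b) = 0 := by
    ext x
    rw [map_sub, LinearMap.sub_apply, h.et_etr, sub_self, LinearMap.zero_apply]
  have h2 := h.counit_es_eq_zero h1 r
  rw [map_sub, map_sub, sub_eq_zero, h.es_etr, h.es_mul] at h2
  exact h2

lemma counit_es (h : C.IsWeakHopf) (a b : A) : C.ε (C.es a b) = C.ε (C.mul a b) := by
  simpa using h.op.counit_etr b a

lemma counit_SMul (h : C.IsWeakHopf) (z : A ⊗[ℂ] A) :
    C.ε (C.SMul z) = C.ε (fstSlice C.ε (C.lE z)) := by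
  have key : ∀ w, C.ε (C.SMul (C.T₁ w)) = C.ε (C.mulT w) := by
    intro w
    induction w with
    | zero => simp
    | add x y hx hy => simp only [map_add, hx, hy]
    | tmul u v => rw [← es_apply, h.counit_es, mulT_tmul]
  rw [← h.SMul_lE, ← h.T₁_R₁, key, h.counit_T₁]

lemma counit_mulS (h : C.IsWeakHopf) (z : A ⊗[ℂ] A) :
    C.ε (C.mulS z) = C.ε (sndSlice C.ε (C.rE z)) := by
  simpa using h.op.counit_SMul (TensorProduct.comm ℂ A A z)

lemma R_T₄ (h : C.IsWeakHopf) (a b c : A) :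
    (id ⊗ₘ C.R c) (C.T₄ (b ⊗ₜ a)) = C.lΔ a (b ⊗ₜ c) := by
  rw [h.lΔ_tmul, h.R_T₁]

lemma lE_lΔ (h : C.IsWeakHopf) (a : A) (z : A ⊗[ℂ] A) : C.lE (C.lΔ a z) = C.lΔ a z := by
  obtain ⟨z, rfl⟩ := (TensorProduct.comm ℂ A A).surjective z
  simpa using h.op.rE_rΔ a z

lemma lE_T₄ (h : C.IsWeakHopf) (a b : A) : C.lE (C.T₄ (b ⊗ₜ a)) = C.T₄ (b ⊗ₜ a) :=
  h.ext_R_snd fun c => by rw [← h.lE_R_snd, h.R_T₄, h.lE_lΔ]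

lemma counit_T₄ (h : C.IsWeakHopf) (a b : A) : sndSlice C.ε (C.T₄ (b ⊗ₜ a)) = C.mul a b :=
  h.ext_L fun c => by
    have h1 := congrArg (sndSlice C.ε) (h.R_T₂ a b c)
    rw [sndSlice_map, sndSlice_map, comp_id, h.counit_T₂] at h1
    simpa [h.mul_assoc] using h1.symm

lemma R₂_S (h : C.IsWeakHopf) (a b : A) :
    C.R₂ (C.S a ⊗ₜ b) = (C.S.toLinearMap ⊗ₘ id) (C.T₄ (a ⊗ₜ b)) :=
  h.ext_R_snd fun c => by
    have hS : C.L (C.S a) ∘ₗ C.S.toLinearMap = C.S.toLinearMap ∘ₗ C.R a := by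
      ext x; simp [h.S_mul]
    have h1 := congrArg (C.S.toLinearMap ⊗ₘ id) (h.R_T₁ b a c)
    simp only [map_map, id_comp, comp_id] at h1
    simp only [h.R_R₂, map_map, id_comp, comp_id, hS, h1]

lemma counit_S (h : C.IsWeakHopf) (a : A) : C.ε (C.S a) = C.ε a := by
  suffices C.ε ∘ₗ C.S.toLinearMap = C.ε from LinearMap.congr_fun this a
  refine LinearMap.ext_on h.span_mul ?_
  rintro _ ⟨a, b, rfl⟩
  have h1 : C.ε (C.SMul (C.T₄ (b ⊗ₜ a))) = C.ε (C.mul a b) := by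
    rw [h.counit_SMul, h.lE_T₄, apply_fstSlice_eq, h.counit_T₄]
  have h2 : C.mulT (C.R₂ (C.S b ⊗ₜ a)) = C.SMul (C.T₄ (b ⊗ₜ a)) := by
    rw [h.R₂_S, SMul, comp_apply]
  rw [comp_apply, LinearEquiv.coe_coe, h.S_mul, ← mulS_tmul, h.counit_mulS, ← h.T₂_R₂,
    h.counit_T₂, h2, h1]

/-! ### The antipode on the legs of the canonical idempotent -/

/-- Let `Δ(g(p)) = (g ⊗ ι)Δ(p)`, as for right multiplications with elements of `A_t`. Such maps are
equal if they agree after application of `ε`, since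
`g(p)c = (ε ⊗ ι)(Δ(g(p))(1 ⊗ c)) = (εg ⊗ ι)(Δ(p)(1 ⊗ c))`. -/
lemma eq_of_counit_comp_eq (h : C.IsWeakHopf) {g g' : A →ₗ[ℂ] A}
    (hg : ∀ p c, C.T₁ (g p ⊗ₜ c) = (g ⊗ₘ id) (C.T₁ (p ⊗ₜ c)))
    (hg' : ∀ p c, C.T₁ (g' p ⊗ₜ c) = (g' ⊗ₘ id) (C.T₁ (p ⊗ₜ c)))
    (hε : ∀ p, C.ε (g p) = C.ε (g' p)) : g = g' := by
  ext p
  refine h.ext_R fun c => ?_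
  have hcomp : C.ε ∘ₗ g = C.ε ∘ₗ g' := LinearMap.ext hε
  rw [← mulT_tmul, ← h.counit_T₁, hg, fstSlice_map, hcomp, ← fstSlice_map, ← hg', h.counit_T₁,
    mulT_tmul]

/-- If `g(pε_t(a)) = pε_t(a')` for all `p`, with `a'` depending only on `a`, then
`Δ(g(p)) = (g ⊗ ι)Δ(p)`: this holds for right multiplication with `ε_t(a')`, and `Aε_t(A) = A`. -/
lemma T₁_of_etr (h : C.IsWeakHopf) {g : A →ₗ[ℂ] A}
    (hg : ∀ a, ∃ a', ∀ p, g (C.etr a p) = C.etr a' p) (p c : A) :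
    C.T₁ (g p ⊗ₜ c) = (g ⊗ₘ id) (C.T₁ (p ⊗ₜ c)) := by
  suffices C.T₁ ∘ₗ (TensorProduct.mk ℂ A A).flip c ∘ₗ g =
    (g ⊗ₘ id) ∘ₗ C.T₁ ∘ₗ (TensorProduct.mk ℂ A A).flip c from LinearMap.congr_fun this p
  refine LinearMap.ext_on h.span_etr ?_
  rintro _ ⟨a, p, rfl⟩
  obtain ⟨a', ha'⟩ := hg a
  have hcomp : g ∘ₗ C.etr a = C.etr a' := LinearMap.ext ha'
  simp only [comp_apply, flip_apply, mk_apply]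
  rw [ha', h.T₁_etr, h.T₁_etr, map_map, hcomp, id_comp]

/-- Left multiplication with a slice of the left leg of `E`: `b ↦ (ι ⊗ f)(E(b ⊗ q))`. -/
def _root_.WMHA.CanonicalMaps.lLeftLeg (C : CanonicalMaps A) (f : A →ₗ[ℂ] ℂ) (q : A) :
    A →ₗ[ℂ] A :=
  sndSlice f ∘ₗ C.lE ∘ₗ (TensorProduct.mk ℂ A A).flip q

lemma lLeftLeg_apply (f : A →ₗ[ℂ] ℂ) (q b : A) :
    C.lLeftLeg f q b = sndSlice f (C.lE (b ⊗ₜ q)) := rfl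

lemma T₂_lLeftLeg (h : C.IsWeakHopf) (f : A →ₗ[ℂ] ℂ) (q d x : A) :
    C.T₂ (d ⊗ₜ C.lLeftLeg f q x) = (id ⊗ₘ C.lLeftLeg f q) (C.T₂ (d ⊗ₜ x)) := by
  refine ext_fstSlice fun ω => ?_
  have h1 := congrArg (sndSlice f) (h.lE_fstSlice_T₂ ω d (x ⊗ₜ q))
  rw [sndSlice_map, comp_id, map_tmul, id_apply] at h1
  rw [fstSlice_map, comp_id]
  exact h1.symm

lemma lLeftLeg_mul (h : C.IsWeakHopf) (f : A →ₗ[ℂ] ℂ) (q a b : A) :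
    C.lLeftLeg f q (C.mul a b) = C.mul (C.lLeftLeg f q a) b := by
  have h1 := congrArg (sndSlice f) (h.lE_R_fst b (a ⊗ₜ q))
  rw [sndSlice_map, comp_id, map_tmul, id_apply] at h1
  exact h1

/-- Right multiplication with `S(z)`, where `z` is a slice of the left leg of `E`. -/
def _root_.WMHA.CanonicalMaps.rSLeftLeg (C : CanonicalMaps A) (f : A →ₗ[ℂ] ℂ) (q : A) :
    A →ₗ[ℂ] A :=
  C.S.toLinearMap ∘ₗ C.lLeftLeg f q ∘ₗ C.S.symm.toLinearMap

lemma rSLeftLeg_S (f : A →ₗ[ℂ] ℂ) (q b : A) :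
    C.rSLeftLeg f q (C.S b) = C.S (C.lLeftLeg f q b) := by
  simp [rSLeftLeg]

lemma rSLeftLeg_mul (h : C.IsWeakHopf) (f : A →ₗ[ℂ] ℂ) (q a b : A) :
    C.rSLeftLeg f q (C.mul a b) = C.mul a (C.rSLeftLeg f q b) := by
  obtain ⟨a, rfl⟩ := C.S.surjective a
  obtain ⟨b, rfl⟩ := C.S.surjective b
  rw [← h.S_mul, rSLeftLeg_S, rSLeftLeg_S, h.lLeftLeg_mul, h.S_mul]

/-- `pε_t(x)S(z) = pε_t(zx)` for `z` a slice of the left leg of `E`. -/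
lemma rSLeftLeg_etr (h : C.IsWeakHopf) (f : A →ₗ[ℂ] ℂ) (q x p : A) :
    C.rSLeftLeg f q (C.etr x p) = C.etr (C.lLeftLeg f q x) p := by
  have key : ∀ z, C.mulS ((id ⊗ₘ C.lLeftLeg f q) z) = C.rSLeftLeg f q (C.mulS z) := by
    intro z
    induction z with
    | zero => simp
    | add x y hx hy => simp only [map_add, hx, hy]
    | tmul u v => simp [h.rSLeftLeg_mul, rSLeftLeg_S]
  rw [etr_apply, etr_apply, h.T₂_lLeftLeg, key]

lemma T₁_rSLeftLeg (h : C.IsWeakHopf) (f : A →ₗ[ℂ] ℂ) (q p c : A) :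
    C.T₁ (C.rSLeftLeg f q p ⊗ₜ c) = (C.rSLeftLeg f q ⊗ₘ id) (C.T₁ (p ⊗ₜ c)) :=
  h.T₁_of_etr (fun a => ⟨_, h.rSLeftLeg_etr f q a⟩) p c

/-- `∑ S(E₍₁₎)ε(E₍₂₎q) = ε_t(q)`. -/
lemma rSLeftLeg_counit (h : C.IsWeakHopf) (q : A) : C.rSLeftLeg C.ε q = C.etr q := by
  refine h.eq_of_counit_comp_eq (h.T₁_rSLeftLeg _ _) (h.T₁_etr q) fun p => ?_
  obtain ⟨b, rfl⟩ := C.S.surjective p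
  rw [rSLeftLeg_S, h.counit_S, h.counit_etr, ← SMul_tmul, h.counit_SMul, apply_fstSlice_eq,
    lLeftLeg_apply]

/-- The antipode on the left leg of `E`: `∑ S(E₍₁₎b) ⊗ E₍₂₎q = ∑ S(b)ε_t(q₍₁₎) ⊗ q₍₂₎`. -/
theorem S_lE (h : C.IsWeakHopf) (b q : A) :
    (C.S.toLinearMap ⊗ₘ id) (C.lE (b ⊗ₜ q)) = C.R₂ (C.T₂ (C.S b ⊗ₜ q)) := by
  refine h.ext_R_snd fun c => ?_
  -- `E(b ⊗ qc) = ∑ (ι ⊗ ε)(E(b ⊗ q₍₁₎)) ⊗ q₍₂₎c`, because the right leg of `E` lies in `A_t`.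
  have key : C.lE (b ⊗ₜ C.mul q c) =
      ((sndSlice C.ε ∘ₗ C.lE ∘ₗ TensorProduct.mk ℂ A A b) ⊗ₘ id) (C.T₁ (q ⊗ₜ c)) := by
    refine ext_fstSlice fun f => ?_
    have h1 := congrArg (fstSlice f) (h.lE_R_snd c (b ⊗ₜ q))
    rw [fstSlice_map, comp_id, map_tmul, id_apply, R_apply, R_apply, ← C.rightLeg_apply f b q,
      ← C.mulT_tmul (C.rightLeg f b q), ← h.counit_T₁] at h1
    have h2 := h.T₁_rightLeg f b (q ⊗ₜ c)
    rw [map_tmul, id_apply] at h2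
    have h3 : C.ε ∘ₗ C.rightLeg f b =
        f ∘ₗ sndSlice C.ε ∘ₗ C.lE ∘ₗ TensorProduct.mk ℂ A A b := by
      ext x; exact apply_fstSlice_eq _ _ _
    rw [h1, h2, fstSlice_map, fstSlice_map, h3]
  have h1 : C.S.toLinearMap ∘ₗ sndSlice C.ε ∘ₗ C.lE ∘ₗ TensorProduct.mk ℂ A A b =
      C.etr.flip (C.S b) := by
    ext x
    rw [flip_apply, ← h.rSLeftLeg_counit, rSLeftLeg_S]
    rfl
  have h2 := h.lE_R_snd c (b ⊗ₜ q)
  rw [map_tmul, id_apply, R_apply, key] at h2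
  rw [h.R_R₂_T₂, ← h1, map_map, id_comp, comp_id, ← comp_id C.S.toLinearMap, ← id_comp (C.R c),
    ← map_map, ← h2, map_map, id_comp, comp_id]

/-! ### Integrals -/

lemma counit_R₂_T₂ (h : C.IsWeakHopf) (z : A ⊗[ℂ] A) :
    fstSlice C.ε (C.R₂ (C.T₂ z)) = fstSlice C.ε (C.T₂ z) := by
  induction z with
  | zero => simp
  | add x y hx hy => simp only [map_add, hx, hy]
  | tmul p q =>
    refine h.ext_R fun c => ?_
    have h1 := congrArg (fstSlice C.ε) (h.R_R₂_T₂ p q c)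
    have h2 := congrArg (fstSlice C.ε) (h.R_T₂_snd q c p)
    have h3 : C.ε ∘ₗ C.etr.flip p = C.ε ∘ₗ C.L p := by
      ext x; exact h.counit_etr p x
    simp only [fstSlice_map, comp_id, id_apply, R_apply, h3] at h1 h2
    rw [h1, h2]

/-- A left integral satisfies `∑ pa₍₁₎φ(a₍₂₎) = ∑ pε_t(a₍₁₎)φ(a₍₂₎)`: both sides are right
multiplications of `p` with elements of `A_t` that agree after application of `ε`. -/
lemma sndSlice_R₂_T₂ (h : C.IsWeakHopf) {φ : A →ₗ[ℂ] ℂ}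
    (hφ : ∀ a b, ∃ b', ∀ p, sndSlice φ (C.T₂ (C.etr b p ⊗ₜ a)) = C.etr b' p) (z : A ⊗[ℂ] A) :
    sndSlice φ (C.R₂ (C.T₂ z)) = sndSlice φ (C.T₂ z) := by
  induction z with
  | zero => simp
  | add x y hx hy => simp only [map_add, hx, hy]
  | tmul p a =>
    have h1 : C.rSLeftLeg φ a = sndSlice φ ∘ₗ C.R₂ ∘ₗ C.T₂ ∘ₗ (TensorProduct.mk ℂ A A).flip a := by
      ext x
      obtain ⟨b, rfl⟩ := C.S.surjective x
      simp only [comp_apply, flip_apply, mk_apply]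
      rw [rSLeftLeg_S, ← h.S_lE, sndSlice_map, comp_id]
      rfl
    have h2 : C.rSLeftLeg φ a = sndSlice φ ∘ₗ C.T₂ ∘ₗ (TensorProduct.mk ℂ A A).flip a := by
      refine h.eq_of_counit_comp_eq (h.T₁_rSLeftLeg _ _) (h.T₁_of_etr (hφ a)) fun x => ?_
      rw [h1]
      simp only [comp_apply, flip_apply, mk_apply]
      rw [← apply_fstSlice_eq, h.counit_R₂_T₂, apply_fstSlice_eq]
    exact LinearMap.congr_fun (h1.symm.trans h2) p

/-- For a left integral, `∑ S(x₍₁₎)φ(x₍₂₎q) = ∑ q₍₁₎φ(xq₍₂₎)`. -/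
theorem S_sndSlice_T₁ (h : C.IsWeakHopf) {φ : A →ₗ[ℂ] ℂ}
    (hφ : ∀ a b, ∃ b', ∀ p, sndSlice φ (C.T₂ (C.etr b p ⊗ₜ a)) = C.etr b' p) (x q : A) :
    C.S (sndSlice φ (C.T₁ (x ⊗ₜ q))) = sndSlice φ (C.T₃ (q ⊗ₜ x)) := by
  refine h.ext_L fun d => ?_
  obtain ⟨d, rfl⟩ := C.S.surjective d
  have key : ∀ z, sndSlice φ (C.rΔ q (C.T₂ ((C.S.toLinearMap ⊗ₘ id) z))) =
      C.S (sndSlice φ (C.lE ((id ⊗ₘ C.R q) z))) := by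
    intro z
    induction z with
    | zero => simp
    | add x y hx hy => simp only [map_add, hx, hy]
    | tmul u v =>
      have h1 := congrArg (sndSlice φ) (h.S_lE u (C.mul v q))
      rw [sndSlice_map, comp_id, h.sndSlice_R₂_T₂ hφ] at h1
      simp only [map_tmul, id_apply, R_apply, LinearEquiv.coe_coe] at h1 ⊢
      rw [← h.T₂_mul, h1]
  have h2 := key (C.T₄ (d ⊗ₜ x))
  rw [← h.R₂_S, h.T₂_R₂, h.rΔ_rE, h.rΔ_tmul, ← h.L_T₃, sndSlice_map, comp_id, h.R_T₄, h.lE_lΔ,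
    h.lΔ_tmul, sndSlice_map, comp_id, R_apply, h.S_mul] at h2
  exact h2.symm

/-- For a right integral, `∑ ψ(xp₍₁₎)S(p₍₂₎) = ∑ ψ(x₍₁₎p)x₍₂₎`. -/
theorem S_fstSlice_T₂ (h : C.IsWeakHopf) {ψ : A →ₗ[ℂ] ℂ}
    (hψ : ∀ a b, ∃ b', ∀ p, fstSlice ψ (C.T₁ (a ⊗ₜ C.es b p)) = C.es b' p) (x p : A) :
    C.S (fstSlice ψ (C.T₂ (x ⊗ₜ p))) = fstSlice ψ (C.T₄ (p ⊗ₜ x)) := by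
  have h1 := h.op.S_sndSlice_T₁ (φ := ψ) (by simpa using hψ) p x
  simpa using h1

lemma R_T₃_fst (h : C.IsWeakHopf) (a b c : A) :
    (C.R b ⊗ₘ id) (C.T₃ (a ⊗ₜ c)) = (id ⊗ₘ C.L c) (C.T₄ (b ⊗ₜ a)) :=
  h.ext_L_fst fun d => by
    have h1 := congrArg (C.R b ⊗ₘ id) (h.L_T₃ a c d)
    have h2 := congrArg (id ⊗ₘ C.L c) (h.R_T₂ a b d)
    simp only [map_map, id_comp, comp_id, ← h.L_comp_R] at h1 h2 ⊢
    rw [h1, h2]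

section Modular

/-! For `φ` and `ψ` with the two antipode relations of left and right integrals, the two sides of
each identity are `(ψ ⊗ φ)` applied to `Δ(x)` multiplied with `p ⊗ q`, on the right, on the left,
or on different sides. -/

variable {φ ψ : A →ₗ[ℂ] ℂ}

theorem integral_right_right (h : C.IsWeakHopf)
    (hφ : ∀ x q, C.S (sndSlice φ (C.T₁ (x ⊗ₜ q))) = sndSlice φ (C.T₃ (q ⊗ₜ x)))
    (hψ : ∀ x p, C.S (fstSlice ψ (C.T₂ (x ⊗ₜ p))) = fstSlice ψ (C.T₄ (p ⊗ₜ x))) (p q x : A) :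
    ψ (C.mul x (sndSlice φ ((id ⊗ₘ C.S.toLinearMap) (C.T₃ (p ⊗ₜ C.S.symm q))))) =
      φ (C.mul x (fstSlice ψ ((C.S.symm.toLinearMap ⊗ₘ id) (C.T₂ (C.S p ⊗ₜ q))))) := by
  obtain ⟨q', rfl⟩ := C.S.surjective q
  have h1 : ψ (C.mul x (sndSlice φ ((id ⊗ₘ C.S.toLinearMap) (C.T₃ (p ⊗ₜ q'))))) =
      φ (fstSlice ψ ((id ⊗ₘ C.R (C.S q')) (C.T₄ (p ⊗ₜ x)))) := by
    have h2 := congrArg (fun z => φ (C.S (fstSlice ψ z))) (h.L_T₃ p q' x)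
    simp only [fstSlice_map, comp_id, id_apply, L_apply, h.S_mul, hψ] at h2
    rw [fstSlice_map, comp_id, R_apply, ← h2, sndSlice_map]
    exact (apply_fstSlice_eq (ψ ∘ₗ C.L x) (φ ∘ₗ C.S.toLinearMap) _).symm
  have h3 : φ (C.mul x (fstSlice ψ ((C.S.symm.toLinearMap ⊗ₘ id) (C.T₂ (C.S p ⊗ₜ C.S q'))))) =
      ψ (sndSlice φ ((C.R p ⊗ₘ id) (C.T₁ (x ⊗ₜ C.S q')))) := by
    have h2 := congrArg (fun z => ψ (C.S.symm (sndSlice φ z))) (h.L_T₃ (C.S q') x (C.S p))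
    simp only [sndSlice_map, comp_id, id_apply, L_apply, ← hφ, ← h.S_mul,
      LinearEquiv.symm_apply_apply] at h2
    rw [sndSlice_map, comp_id, R_apply, h2, fstSlice_map]
    exact apply_fstSlice_eq (ψ ∘ₗ C.S.symm.toLinearMap) (φ ∘ₗ C.L x) _
  rw [LinearEquiv.symm_apply_apply, h1, h3, h.R_T₁, apply_fstSlice_eq]

theorem integral_right_left (h : C.IsWeakHopf)
    (hφ : ∀ x q, C.S (sndSlice φ (C.T₁ (x ⊗ₜ q))) = sndSlice φ (C.T₃ (q ⊗ₜ x)))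
    (hψ : ∀ x p, C.S (fstSlice ψ (C.T₂ (x ⊗ₜ p))) = fstSlice ψ (C.T₄ (p ⊗ₜ x))) (p q x : A) :
    ψ (C.mul x (sndSlice φ ((id ⊗ₘ C.S.toLinearMap) (C.T₁ (p ⊗ₜ C.S.symm q))))) =
      φ (C.mul (fstSlice ψ ((C.S.toLinearMap ⊗ₘ id) (C.T₂ (C.S.symm p ⊗ₜ q)))) x) := by
  have h1 : ψ (C.mul x (sndSlice φ ((id ⊗ₘ C.S.toLinearMap) (C.T₁ (p ⊗ₜ C.S.symm q))))) =
      φ (fstSlice ψ ((id ⊗ₘ C.L q) (C.T₄ (p ⊗ₜ x)))) := by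
    have h2 := congrArg (fun z => φ (C.S (fstSlice ψ z))) (h.R_T₂_snd p (C.S.symm q) x)
    simp only [fstSlice_map, comp_id, id_apply, R_apply, h.S_mul, hψ,
      LinearEquiv.apply_symm_apply] at h2
    rw [fstSlice_map, comp_id, L_apply, h2, sndSlice_map]
    exact (apply_fstSlice_eq (ψ ∘ₗ C.L x) (φ ∘ₗ C.S.toLinearMap) _).symm
  have h3 : φ (C.mul (fstSlice ψ ((C.S.toLinearMap ⊗ₘ id) (C.T₂ (C.S.symm p ⊗ₜ q)))) x) =
      ψ (sndSlice φ ((C.R p ⊗ₘ id) (C.T₃ (x ⊗ₜ q)))) := by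
    have h2 := congrArg (fun z => ψ (C.S (sndSlice φ z))) (h.R_T₂_snd q x (C.S.symm p))
    simp only [sndSlice_map, comp_id, id_apply, L_apply, hφ, h.S_mul,
      LinearEquiv.apply_symm_apply] at h2
    rw [sndSlice_map, comp_id, R_apply, ← h2, fstSlice_map]
    exact apply_fstSlice_eq (ψ ∘ₗ C.S.toLinearMap) (φ ∘ₗ C.R x) _
  rw [h1, h3, h.R_T₃_fst, apply_fstSlice_eq]

theorem integral_left_right (h : C.IsWeakHopf)
    (hφ : ∀ x q, C.S (sndSlice φ (C.T₁ (x ⊗ₜ q))) = sndSlice φ (C.T₃ (q ⊗ₜ x)))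
    (hψ : ∀ x p, C.S (fstSlice ψ (C.T₂ (x ⊗ₜ p))) = fstSlice ψ (C.T₄ (p ⊗ₜ x))) (p q x : A) :
    ψ (C.mul (sndSlice φ ((id ⊗ₘ C.S.symm.toLinearMap) (C.T₃ (p ⊗ₜ C.S q)))) x) =
      φ (C.mul x (fstSlice ψ ((C.S.symm.toLinearMap ⊗ₘ id) (C.T₄ (C.S p ⊗ₜ q))))) := by
  have h1 : ψ (C.mul (sndSlice φ ((id ⊗ₘ C.S.symm.toLinearMap) (C.T₃ (p ⊗ₜ C.S q)))) x) =
      φ (fstSlice ψ ((id ⊗ₘ C.R q) (C.T₂ (p ⊗ₜ x)))) := by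
    have h2 := congrArg (fun z => φ (C.S.symm (fstSlice ψ z))) (h.R_T₃_fst p x (C.S q))
    simp only [fstSlice_map, comp_id, id_apply, L_apply, ← hψ, ← h.S_mul,
      LinearEquiv.symm_apply_apply] at h2
    rw [fstSlice_map, comp_id, R_apply, ← h2, sndSlice_map]
    exact (apply_fstSlice_eq (ψ ∘ₗ C.R x) (φ ∘ₗ C.S.symm.toLinearMap) _).symm
  have h3 : φ (C.mul x (fstSlice ψ ((C.S.symm.toLinearMap ⊗ₘ id) (C.T₄ (C.S p ⊗ₜ q))))) =
      ψ (sndSlice φ ((C.L p ⊗ₘ id) (C.T₁ (x ⊗ₜ q)))) := by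
    have h2 := congrArg (fun z => ψ (C.S.symm (sndSlice φ z))) (h.R_T₃_fst q (C.S p) x)
    simp only [sndSlice_map, comp_id, id_apply, R_apply, ← hφ, ← h.S_mul,
      LinearEquiv.symm_apply_apply] at h2
    rw [sndSlice_map, comp_id, L_apply, h2, fstSlice_map]
    exact apply_fstSlice_eq (ψ ∘ₗ C.S.symm.toLinearMap) (φ ∘ₗ C.L x) _
  rw [h1, h3, h.R_T₂_snd, apply_fstSlice_eq]

theorem integral_left_left (h : C.IsWeakHopf)
    (hφ : ∀ x q, C.S (sndSlice φ (C.T₁ (x ⊗ₜ q))) = sndSlice φ (C.T₃ (q ⊗ₜ x)))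
    (hψ : ∀ x p, C.S (fstSlice ψ (C.T₂ (x ⊗ₜ p))) = fstSlice ψ (C.T₄ (p ⊗ₜ x))) (p q x : A) :
    ψ (C.mul (sndSlice φ ((id ⊗ₘ C.S.symm.toLinearMap) (C.T₁ (p ⊗ₜ C.S q)))) x) =
      φ (C.mul (fstSlice ψ ((C.S.toLinearMap ⊗ₘ id) (C.T₄ (C.S.symm p ⊗ₜ q)))) x) := by
  have h1 := h.op.integral_right_right (φ := ψ) (ψ := φ) (by simpa using fun x q => hψ q x)
    (by simpa using fun x q => hφ q x) q p x
  simpa [TensorProduct.map_comm] using h1.symm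

end Modular

end IsWeakHopf
end CanonicalMaps
/-! ### Multipliers of tensor products -/

section TripleTensors

variable {A : Type*} [NonUnitalRing A] [Module ℂ A]

lemma onFstTwo_assoc (T : A ⊗[ℂ] A →ₗ[ℂ] A ⊗[ℂ] A) (z : A ⊗[ℂ] A) (c : A) :
    onFstTwo T (TensorProduct.assoc ℂ A A A (z ⊗ₜ c)) = TensorProduct.assoc ℂ A A A (T z ⊗ₜ c) := by
  simp [onFstTwo]

lemma onFstTwo_tmul (T : A ⊗[ℂ] A →ₗ[ℂ] A ⊗[ℂ] A) (a b c : A) :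
    onFstTwo T (a ⊗ₜ (b ⊗ₜ c)) = TensorProduct.assoc ℂ A A A (T (a ⊗ₜ b) ⊗ₜ c) :=
  onFstTwo_assoc T (a ⊗ₜ b) c

lemma onLastTwo_tmul (T : A ⊗[ℂ] A →ₗ[ℂ] A ⊗[ℂ] A) (a : A) (z : A ⊗[ℂ] A) :
    onLastTwo T (a ⊗ₜ z) = a ⊗ₜ T z := by
  simp [onLastTwo]

lemma onOuterTwo_tmul (T : A ⊗[ℂ] A →ₗ[ℂ] A ⊗[ℂ] A) (a b c : A) :
    onOuterTwo T (a ⊗ₜ (b ⊗ₜ c)) = TensorProduct.leftComm ℂ A A A (b ⊗ₜ T (a ⊗ₜ c)) := by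
  simp [onOuterTwo, onLastTwo]

/-- The slice of the last of three tensor factors. -/
lemma sndSlice_map_sndSlice_assoc (f : A →ₗ[ℂ] ℂ) (z : A ⊗[ℂ] A) (c : A) :
    (id ⊗ₘ sndSlice f) (TensorProduct.assoc ℂ A A A (z ⊗ₜ c)) = f c • z := by
  induction z with
  | zero => simp
  | add x y hx hy => simp only [map_add, add_tmul, hx, hy, smul_add]
  | tmul p q => simp

lemma fstSlice_assoc (f : A →ₗ[ℂ] ℂ) (z : A ⊗[ℂ] A) (c : A) :
    fstSlice f (TensorProduct.assoc ℂ A A A (z ⊗ₜ c)) = fstSlice f z ⊗ₜ c := by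
  induction z with
  | zero => simp
  | add x y hx hy => simp only [map_add, add_tmul, hx, hy]
  | tmul p q => simp [smul_tmul']

lemma fstSlice_onLastTwo (f : A →ₗ[ℂ] ℂ) (T : A ⊗[ℂ] A →ₗ[ℂ] A ⊗[ℂ] A)
    (z : A ⊗[ℂ] (A ⊗[ℂ] A)) : fstSlice f (onLastTwo T z) = T (fstSlice f z) := by
  rw [onLastTwo, fstSlice_map, comp_id]

lemma map_sndSlice_onFstTwo (f : A →ₗ[ℂ] ℂ) (T : A ⊗[ℂ] A →ₗ[ℂ] A ⊗[ℂ] A)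
    (z : A ⊗[ℂ] (A ⊗[ℂ] A)) :
    (id ⊗ₘ sndSlice f) (onFstTwo T z) = T ((id ⊗ₘ sndSlice f) z) := by
  obtain ⟨z, rfl⟩ := (TensorProduct.assoc ℂ A A A).surjective z
  induction z with
  | zero => simp
  | add x y hx hy => simp only [map_add, hx, hy]
  | tmul p q => rw [onFstTwo_assoc, sndSlice_map_sndSlice_assoc, sndSlice_map_sndSlice_assoc,
      map_smul]

end TripleTensors

section Multiplier

variable {A : Type*} [NonUnitalRing A] [Module ℂ A] [IsScalarTower ℂ A A] [SMulCommClass ℂ A A]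

lemma tmul_mul_eq_map (b b' : A) (z : A ⊗[ℂ] A) :
    (b ⊗ₜ b') * z = (mulLeft ℂ b ⊗ₘ mulLeft ℂ b') z := by
  induction z with
  | zero => simp
  | add x y hx hy => simp only [map_add, mul_add, hx, hy]
  | tmul p q => simp

lemma mul_lact (m : MultiplierAlgebra (A ⊗[ℂ] A)) (z w : A ⊗[ℂ] A) :
    z * lact m w = ract m z * w :=
  (m.2 z w).symm

lemma tensor_ext_left (hA : IsNondegenerate A) {z w : A ⊗[ℂ] A} (h : ∀ y, y * z = y * w) :
    z = w := by
  refine ext_map_fst (g := fun a : A => mulLeft ℂ a) hA.2 fun a =>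
    ext_map_snd (g := fun a : A => mulLeft ℂ a) hA.2 fun b => ?_
  have h1 := h (a ⊗ₜ b)
  rw [tmul_mul_eq_map, tmul_mul_eq_map] at h1
  simpa only [map_map, id_comp, comp_id] using h1

lemma lact_mul (hA : IsNondegenerate A) (m : MultiplierAlgebra (A ⊗[ℂ] A)) (z w : A ⊗[ℂ] A) :
    lact m (z * w) = lact m z * w :=
  tensor_ext_left hA fun y => by rw [mul_lact, ← mul_assoc, ← mul_assoc, mul_lact]

lemma ract_mul (hA : IsNondegenerate A) (m : MultiplierAlgebra (A ⊗[ℂ] A)) (z w : A ⊗[ℂ] A) :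
    ract m (z * w) = z * ract m w :=
  tensor_ext hA fun y => by rw [← mul_lact, mul_assoc, mul_lact, ← mul_assoc]

/-- An element of `A ⊗ (A ⊗ A)` is determined by left multiplication with it. -/
lemma tensor₃_ext (hA : IsNondegenerate A) {z w : A ⊗[ℂ] (A ⊗[ℂ] A)}
    (h : ∀ y, z * y = w * y) : z = w := by
  have key : ∀ (a : A) (b : A ⊗[ℂ] A) (z : A ⊗[ℂ] (A ⊗[ℂ] A)),
      z * (a ⊗ₜ b) = (mulRight ℂ a ⊗ₘ mulRight ℂ b) z := by
    intro a b z
    induction z with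
    | zero => simp
    | add x y hx hy => simp only [map_add, add_mul, hx, hy]
    | tmul p q => simp
  have hA₂ : ∀ x : A ⊗[ℂ] A, (∀ y, mulRight ℂ y x = 0) → x = 0 := fun x hx =>
    tensor_ext hA fun y => by simpa using hx y
  refine ext_map_fst (g := fun a : A => mulRight ℂ a) hA.1 fun a =>
    ext_map_snd (g := fun a : A ⊗[ℂ] A => mulRight ℂ a) hA₂ fun b => ?_
  have h1 := h (a ⊗ₜ b)
  rw [key, key] at h1
  simpa only [map_map, id_comp, comp_id] using h1

/-- If `T` and `T'` are adjoint with respect to the product of `A ⊗ A`, then so are `ι ⊗ T` and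
`ι ⊗ T'`. -/
lemma mul_onLastTwo {T T' : A ⊗[ℂ] A →ₗ[ℂ] A ⊗[ℂ] A} (h : ∀ z w, z * T w = T' z * w)
    (x y : A ⊗[ℂ] (A ⊗[ℂ] A)) : x * onLastTwo T y = onLastTwo T' x * y := by
  induction x with
  | zero => simp
  | add x₁ x₂ h₁ h₂ => simp only [map_add, add_mul, h₁, h₂]
  | tmul a z =>
    induction y with
    | zero => simp
    | add y₁ y₂ h₁ h₂ => simp only [map_add, mul_add, h₁, h₂]
    | tmul b w => simp [onLastTwo_tmul, h]

lemma assoc_mul (x y : (A ⊗[ℂ] A) ⊗[ℂ] A) :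
    TensorProduct.assoc ℂ A A A (x * y) =
      TensorProduct.assoc ℂ A A A x * TensorProduct.assoc ℂ A A A y := by
  induction x with
  | zero => simp
  | add x₁ x₂ h₁ h₂ => simp only [map_add, add_mul, h₁, h₂]
  | tmul z a =>
    induction y with
    | zero => simp
    | add y₁ y₂ h₁ h₂ => simp only [map_add, mul_add, h₁, h₂]
    | tmul w b =>
      induction z with
      | zero => simp
      | add z₁ z₂ h₁ h₂ =>
        simp only [Algebra.TensorProduct.tmul_mul_tmul] at h₁ h₂ ⊢
        simp only [add_mul, add_tmul, map_add, h₁, h₂]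
      | tmul p q =>
        induction w with
        | zero => simp
        | add w₁ w₂ h₁ h₂ =>
          simp only [Algebra.TensorProduct.tmul_mul_tmul] at h₁ h₂ ⊢
          simp only [mul_add, add_tmul, map_add, h₁, h₂]
        | tmul r s => simp

lemma mul_onFstTwo {T T' : A ⊗[ℂ] A →ₗ[ℂ] A ⊗[ℂ] A} (h : ∀ z w, z * T w = T' z * w)
    (x y : A ⊗[ℂ] (A ⊗[ℂ] A)) : x * onFstTwo T y = onFstTwo T' x * y := by
  obtain ⟨x, rfl⟩ := (TensorProduct.assoc ℂ A A A).surjective x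
  obtain ⟨y, rfl⟩ := (TensorProduct.assoc ℂ A A A).surjective y
  induction x with
  | zero => simp
  | add x₁ x₂ h₁ h₂ => simp only [map_add, add_mul, h₁, h₂]
  | tmul z a =>
    induction y with
    | zero => simp
    | add y₁ y₂ h₁ h₂ => simp only [map_add, mul_add, h₁, h₂]
    | tmul w b =>
      rw [onFstTwo_assoc, onFstTwo_assoc, ← assoc_mul, ← assoc_mul,
        Algebra.TensorProduct.tmul_mul_tmul, Algebra.TensorProduct.tmul_mul_tmul, h]

end Multiplier

/-! ### The canonical maps of a regular weak multiplier Hopf algebra -/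

namespace RegularWeakMultiplierHopfAlgebra

variable {A : Type*} [NonUnitalRing A] [Module ℂ A] [IsScalarTower ℂ A A] [SMulCommClass ℂ A A]
  (H : RegularWeakMultiplierHopfAlgebra A)

/-- The linear maps that make up a regular weak multiplier Hopf algebra. -/
def canonicalMaps : CanonicalMaps A where
  mul := LinearMap.mul ℂ A
  T₁ := H.T₁
  T₂ := H.T₂
  T₃ := H.T₃
  T₄ := H.T₄
  lΔ a := lact (H.Δ a)
  rΔ a := ract (H.Δ a)
  lE := lact H.E
  rE := ract H.E
  R₁ := H.R₁
  R₂ := H.R₂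
  S := H.S
  ε := H.ε

lemma T₁_tmul_mul (a b : A) (y : A ⊗[ℂ] A) :
    H.T₁ (a ⊗ₜ b) * y = lact (H.Δ a) ((id ⊗ₘ mulLeft ℂ b) y) :=
  congrArg (fun m => lact m y) (H.T₁_spec a b)

lemma T₂_tmul_mul (c a : A) (y : A ⊗[ℂ] A) :
    H.T₂ (c ⊗ₜ a) * y = (mulLeft ℂ c ⊗ₘ id) (lact (H.Δ a) y) :=
  congrArg (fun m => lact m y) (H.T₂_spec c a)

lemma T₃_tmul_mul (a b : A) (y : A ⊗[ℂ] A) :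
    H.T₃ (a ⊗ₜ b) * y = (id ⊗ₘ mulLeft ℂ b) (lact (H.Δ a) y) :=
  congrArg (fun m => lact m y) (H.T₃_spec a b)

lemma T₄_tmul_mul (b a : A) (y : A ⊗[ℂ] A) :
    H.T₄ (b ⊗ₜ a) * y = lact (H.Δ a) ((mulLeft ℂ b ⊗ₘ id) y) :=
  congrArg (fun m => lact m y) (H.T₄_spec b a)

lemma lact_Δ_mul (a b : A) (y : A ⊗[ℂ] A) :
    lact (H.Δ (a * b)) y = lact (H.Δ a) (lact (H.Δ b) y) :=
  congrArg (fun m => lact m y) (map_mul H.Δ a b)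

lemma lact_E_lact_E (y : A ⊗[ℂ] A) : lact H.E (lact H.E y) = lact H.E y :=
  congrArg (fun m => lact m y) H.E_idem

lemma ract_E_ract_E (y : A ⊗[ℂ] A) : ract H.E (ract H.E y) = ract H.E y :=
  congrArg (fun m => ract m y) H.E_idem

lemma T₁_R₁_apply (z : A ⊗[ℂ] A) : H.T₁ (H.R₁ z) = lact H.E z := LinearMap.congr_fun H.T₁_R₁ z

lemma T₂_R₂_apply (z : A ⊗[ℂ] A) : H.T₂ (H.R₂ z) = ract H.E z := LinearMap.congr_fun H.T₂_R₂ z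

lemma lact_E_T₁ (z : A ⊗[ℂ] A) : lact H.E (H.T₁ z) = H.T₁ z := by
  obtain ⟨y, hy⟩ : H.T₁ z ∈ LinearMap.range (lact H.E) := H.range_T₁ ▸ ⟨z, rfl⟩
  rw [← hy, lact_E_lact_E]

lemma ract_E_T₂ (z : A ⊗[ℂ] A) : ract H.E (H.T₂ z) = H.T₂ z := by
  obtain ⟨y, hy⟩ : H.T₂ z ∈ LinearMap.range (ract H.E) := H.range_T₂ ▸ ⟨z, rfl⟩
  rw [← hy, ract_E_ract_E]

lemma coassoc_apply (z : A ⊗[ℂ] (A ⊗[ℂ] A)) :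
    onFstTwo H.T₂ (onLastTwo H.T₁ z) = onLastTwo H.T₁ (onFstTwo H.T₂ z) :=
  LinearMap.congr_fun H.coassoc z

lemma span_sndSlice_T₁ :
    Submodule.span ℂ {x | ∃ z f, sndSlice f (H.canonicalMaps.T₁ z) = x} = ⊤ := by
  rw [eq_top_iff, ← H.full_left]
  refine Submodule.span_mono ?_
  rintro _ ⟨a, b, f, rfl⟩
  exact ⟨a ⊗ₜ b, f, rfl⟩

lemma span_fstSlice_T₂ :
    Submodule.span ℂ {x | ∃ z f, fstSlice f (H.canonicalMaps.T₂ z) = x} = ⊤ := by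
  rw [eq_top_iff, ← H.full_right]
  refine Submodule.span_mono ?_
  rintro _ ⟨a, b, f, rfl⟩
  exact ⟨a ⊗ₜ b, f, rfl⟩

/-- `(c ⊗ 1)R₁T₁(q ⊗ p) = ∑ cq₍₁₎ ⊗ ε_s(q₍₂₎)p`. -/
lemma map_R₁_T₁ (p q c : A) :
    (mulLeft ℂ c ⊗ₘ id) (H.R₁ (H.T₁ (q ⊗ₜ p))) =
      (id ⊗ₘ H.canonicalMaps.es.flip p) (H.T₂ (c ⊗ₜ q)) := by
  have h1 : ∀ (z : A ⊗[ℂ] A) (v : A), (id ⊗ₘ H.canonicalMaps.SMul)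
      (TensorProduct.assoc ℂ A A A (z ⊗ₜ v)) = (id ⊗ₘ (mulRight ℂ v ∘ₗ H.S.toLinearMap)) z := by
    intro z v
    induction z with
    | zero => simp
    | add x y hx hy => simp only [map_add, add_tmul, hx, hy]
    | tmul x y => simp; rfl
  have h2 : ∀ w, (mulLeft ℂ c ⊗ₘ id) (H.R₁ w) =
      (id ⊗ₘ H.canonicalMaps.SMul) (onFstTwo H.T₂ (c ⊗ₜ w)) := by
    intro w
    induction w with
    | zero => simp
    | add x y hx hy => simp only [map_add, tmul_add, hx, hy]
    | tmul u v => rw [onFstTwo_tmul, h1, H.R₁_spec]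
  have h3 : ∀ z : A ⊗[ℂ] A, (id ⊗ₘ H.canonicalMaps.SMul)
      (onLastTwo H.T₁ (TensorProduct.assoc ℂ A A A (z ⊗ₜ p))) =
        (id ⊗ₘ H.canonicalMaps.es.flip p) z := by
    intro z
    induction z with
    | zero => simp
    | add x y hx hy => simp only [map_add, add_tmul, hx, hy]
    | tmul x y => simp [onLastTwo_tmul]; rfl
  rw [h2, ← onLastTwo_tmul, coassoc_apply, onFstTwo_tmul, h3]

/-- `R₂T₂(p ⊗ q)(1 ⊗ c) = ∑ pε_t(q₍₁₎) ⊗ q₍₂₎c`. -/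
lemma map_R₂_T₂ (p q c : A) :
    (id ⊗ₘ mulRight ℂ c) (H.R₂ (H.T₂ (p ⊗ₜ q))) =
      (H.canonicalMaps.etr.flip p ⊗ₘ id) (H.T₁ (q ⊗ₜ c)) := by
  have h1 : ∀ (z : A ⊗[ℂ] A) (u : A), (H.canonicalMaps.mulS ⊗ₘ id)
      ((TensorProduct.assoc ℂ A A A).symm (u ⊗ₜ z)) =
        ((mulLeft ℂ u ∘ₗ H.S.toLinearMap) ⊗ₘ id) z := by
    intro z v
    induction z with
    | zero => simp
    | add x y hx hy => simp only [map_add, tmul_add, hx, hy]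
    | tmul x y => simp; rfl
  have h2 : ∀ w, (id ⊗ₘ mulRight ℂ c) (H.R₂ w) = (H.canonicalMaps.mulS ⊗ₘ id)
      ((TensorProduct.assoc ℂ A A A).symm
        (onLastTwo H.T₁ (TensorProduct.assoc ℂ A A A (w ⊗ₜ c)))) := by
    intro w
    induction w with
    | zero => simp
    | add x y hx hy => simp only [map_add, add_tmul, hx, hy]
    | tmul u v => rw [assoc_tmul, onLastTwo_tmul, h1, H.R₂_spec]
  have h3 : ∀ z : A ⊗[ℂ] A, (H.canonicalMaps.mulS ⊗ₘ id)
      ((TensorProduct.assoc ℂ A A A).symm (onFstTwo H.T₂ (p ⊗ₜ z))) =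
        (H.canonicalMaps.etr.flip p ⊗ₘ id) z := by
    intro z
    induction z with
    | zero => simp
    | add x y hx hy => simp only [map_add, tmul_add, hx, hy]
    | tmul x y => simp [onFstTwo_tmul]; rfl
  rw [h2, ← onFstTwo_assoc, assoc_tmul, ← coassoc_apply, onLastTwo_tmul, h3]

/-- `∑ ε_s(a₍₁₎)b ⊗ a₍₂₎c = (1 ⊗ a)E(b ⊗ c)`. This is the description of the kernel of `T₁`, in
which the first leg of `Δ(a)` is removed because it is all of `A`. -/
lemma map_es_T₁ (a b c : A) :
    (H.canonicalMaps.es.flip b ⊗ₘ id) (H.T₁ (a ⊗ₜ c)) =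
      (id ⊗ₘ mulLeft ℂ a) (lact H.E (b ⊗ₜ c)) := by
  let Q : A →ₗ[ℂ] A ⊗[ℂ] A := (H.canonicalMaps.es.flip b ⊗ₘ id) ∘ₗ H.T₁ ∘ₗ
    (TensorProduct.mk ℂ A A).flip c
  let Q' : A →ₗ[ℂ] A ⊗[ℂ] A :=
    (LinearMap.lTensorHom A ∘ₗ LinearMap.mul ℂ A).flip (lact H.E (b ⊗ₜ c))
  suffices Q = Q' from LinearMap.congr_fun this a
  have h1 : ∀ (d : A) (z : A ⊗[ℂ] A), (mulLeft ℂ d ⊗ₘ id)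
      (onFstTwo H.G₁ (TensorProduct.leftComm ℂ A A A (b ⊗ₜ z))) =
        (id ⊗ₘ (H.canonicalMaps.es.flip b ⊗ₘ id)) (onFstTwo H.T₂ (d ⊗ₜ z)) := by
    intro d z
    induction z with
    | zero => simp
    | add x y hx hy => simp only [map_add, tmul_add, hx, hy]
    | tmul u v =>
      have h2 : ∀ (f g : A →ₗ[ℂ] A) (w : A ⊗[ℂ] A),
          (f ⊗ₘ (g ⊗ₘ id)) (TensorProduct.assoc ℂ A A A (w ⊗ₜ v)) =
            TensorProduct.assoc ℂ A A A ((f ⊗ₘ g) w ⊗ₜ v) := by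
        intro f g w
        induction w with
        | zero => simp
        | add x y hx hy => simp only [map_add, add_tmul, hx, hy]
        | tmul x y => simp
      rw [leftComm_tmul, onFstTwo_tmul, onFstTwo_tmul, h2, ← TensorProduct.map_id, h2,
        ← H.R₁_T₁, comp_apply, map_R₁_T₁]
  have h3 : ∀ (d a : A) (z : A ⊗[ℂ] A), (mulLeft ℂ d ⊗ₘ id) (onOuterTwo H.T₁ (a ⊗ₜ z)) =
      (id ⊗ₘ (LinearMap.lTensorHom A ∘ₗ LinearMap.mul ℂ A).flip z) (H.T₂ (d ⊗ₜ a)) := by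
    intro d a z
    induction z with
    | zero => simp
    | add x y hx hy => simp only [map_add, tmul_add, hx, hy, map_add_right, LinearMap.add_apply]
    | tmul u v =>
      have h4 : ∀ w : A ⊗[ℂ] A, (mulLeft ℂ d ⊗ₘ id) (TensorProduct.leftComm ℂ A A A (u ⊗ₜ w)) =
          TensorProduct.leftComm ℂ A A A (u ⊗ₜ (mulLeft ℂ d ⊗ₘ id) w) := by
        intro w
        induction w with
        | zero => simp
        | add x y hx hy => simp only [map_add, tmul_add, hx, hy]
        | tmul x y => simp
      have h5 : (mulLeft ℂ d ⊗ₘ id) (H.T₁ (a ⊗ₜ v)) = (id ⊗ₘ mulRight ℂ v) (H.T₂ (d ⊗ₜ a)) :=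
        tensor_ext H.nondegenerate fun y => by
          rw [map_mulLeft_id_mul, map_id_mulRight_mul, T₁_tmul_mul, T₂_tmul_mul]
      rw [onOuterTwo_tmul, h4, h5]
      generalize H.T₂ (d ⊗ₜ a) = w
      induction w with
      | zero => simp
      | add x y hx hy => simp only [map_add, tmul_add, hx, hy]
      | tmul x y => simp
  have h6 : ∀ d a, (id ⊗ₘ Q) (H.T₂ (d ⊗ₜ a)) = (id ⊗ₘ Q') (H.T₂ (d ⊗ₜ a)) := by
    intro d a
    have h7 := congrArg (mulLeft ℂ d ⊗ₘ id) (LinearMap.congr_fun H.G₁_spec (a ⊗ₜ (b ⊗ₜ c)))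
    rw [comp_apply, comp_apply, onLastTwo_tmul, h3, onOuterTwo_tmul, h1, ← onLastTwo_tmul,
      coassoc_apply, onFstTwo_tmul] at h7
    rw [← h7]
    generalize H.T₂ (d ⊗ₜ a) = w
    induction w with
    | zero => simp
    | add x y hx hy => simp only [map_add, add_tmul, hx, hy]
    | tmul x y => simp [Q, onLastTwo_tmul]
  refine LinearMap.ext_on H.span_fstSlice_T₂ ?_
  rintro _ ⟨z, f, rfl⟩
  induction z with
  | zero => simp
  | add x y hx hy => rw [map_add, map_add, map_add, map_add, hx, hy]
  | tmul d a =>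
    have h8 := congrArg (fstSlice f) (h6 d a)
    rw [fstSlice_map, fstSlice_map] at h8
    exact h8

/-- `∑ ca₍₁₎ ⊗ bε_t(a₍₂₎) = (c ⊗ b)E(a ⊗ 1)`, from the description of the kernel of `T₂`. -/
lemma map_etr_T₂ (a b c : A) :
    (id ⊗ₘ H.canonicalMaps.etr.flip b) (H.T₂ (c ⊗ₜ a)) =
      (mulRight ℂ a ⊗ₘ id) (ract H.E (c ⊗ₜ b)) := by
  let Q : A →ₗ[ℂ] A ⊗[ℂ] A := (id ⊗ₘ H.canonicalMaps.etr.flip b) ∘ₗ H.T₂ ∘ₗ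
    TensorProduct.mk ℂ A A c
  let Q' : A →ₗ[ℂ] A ⊗[ℂ] A :=
    (LinearMap.rTensorHom A ∘ₗ (LinearMap.mul ℂ A).flip).flip (ract H.E (c ⊗ₜ b))
  suffices Q = Q' from LinearMap.congr_fun this a
  have h1 : ∀ (e : A) (u v : A), (id ⊗ₘ (id ⊗ₘ mulRight ℂ e))
      (onLastTwo H.G₂ (u ⊗ₜ (b ⊗ₜ v))) =
        (id ⊗ₘ (H.canonicalMaps.etr.flip b ⊗ₘ id)) (onLastTwo H.T₁ (u ⊗ₜ (v ⊗ₜ e))) := by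
    intro e u v
    rw [onLastTwo_tmul, onLastTwo_tmul, map_tmul, map_tmul, ← H.R₂_T₂, comp_apply, map_R₂_T₂]
  have h2 : ∀ (e : A) (z : A ⊗[ℂ] A), (id ⊗ₘ (id ⊗ₘ mulRight ℂ e))
      (onLastTwo H.G₂ (TensorProduct.leftComm ℂ A A A (b ⊗ₜ z))) =
        (id ⊗ₘ (H.canonicalMaps.etr.flip b ⊗ₘ id))
          (onLastTwo H.T₁ (TensorProduct.assoc ℂ A A A (z ⊗ₜ e))) := by
    intro e z
    induction z with
    | zero => simp
    | add x y hx hy => simp only [map_add, tmul_add, add_tmul, hx, hy]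
    | tmul u v => rw [leftComm_tmul, assoc_tmul, h1]
  have h3 : ∀ (e a : A) (z : A ⊗[ℂ] A), (id ⊗ₘ (id ⊗ₘ mulRight ℂ e))
      (onOuterTwo H.T₂ (TensorProduct.assoc ℂ A A A (z ⊗ₜ a))) =
        TensorProduct.assoc ℂ A A A
          (((LinearMap.rTensorHom A ∘ₗ (LinearMap.mul ℂ A).flip).flip z ⊗ₘ id)
            (H.T₁ (a ⊗ₜ e))) := by
    intro e a z
    induction z with
    | zero => simp
    | add x y hx hy =>
      simp only [map_add, add_tmul, hx, hy, map_add_left, LinearMap.add_apply]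
    | tmul u v =>
      have h4 : ∀ w : A ⊗[ℂ] A,
          (id ⊗ₘ (id ⊗ₘ mulRight ℂ e)) (TensorProduct.leftComm ℂ A A A (v ⊗ₜ w)) =
            TensorProduct.leftComm ℂ A A A (v ⊗ₜ (id ⊗ₘ mulRight ℂ e) w) := by
        intro w
        induction w with
        | zero => simp
        | add x y hx hy => simp only [map_add, tmul_add, hx, hy]
        | tmul x y => simp
      have h5 : (id ⊗ₘ mulRight ℂ e) (H.T₂ (u ⊗ₜ a)) = (mulLeft ℂ u ⊗ₘ id) (H.T₁ (a ⊗ₜ e)) :=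
        tensor_ext H.nondegenerate fun y => by
          rw [map_mulLeft_id_mul, map_id_mulRight_mul, T₁_tmul_mul, T₂_tmul_mul]
      rw [assoc_tmul, onOuterTwo_tmul, h4, h5]
      generalize H.T₁ (a ⊗ₜ e) = w
      induction w with
      | zero => simp
      | add x y hx hy => simp only [map_add, tmul_add, hx, hy]
      | tmul x y => simp
  have h6 : ∀ a e, TensorProduct.assoc ℂ A A A ((Q ⊗ₘ id) (H.T₁ (a ⊗ₜ e))) =
      TensorProduct.assoc ℂ A A A ((Q' ⊗ₘ id) (H.T₁ (a ⊗ₜ e))) := by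
    intro a e
    have h7 := congrArg (id ⊗ₘ (id ⊗ₘ mulRight ℂ e))
      (LinearMap.congr_fun H.G₂_spec (c ⊗ₜ (b ⊗ₜ a)))
    rw [comp_apply, comp_apply, onOuterTwo_tmul, h2, onFstTwo_tmul, h3, ← onFstTwo_assoc,
      assoc_tmul, ← coassoc_apply, onLastTwo_tmul] at h7
    rw [← h7]
    generalize H.T₁ (a ⊗ₜ e) = w
    induction w with
    | zero => simp
    | add x y hx hy => simp only [map_add, tmul_add, hx, hy]
    | tmul x y =>
      have h8 : ∀ w : A ⊗[ℂ] A, (id ⊗ₘ (H.canonicalMaps.etr.flip b ⊗ₘ id))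
          (TensorProduct.assoc ℂ A A A (w ⊗ₜ y)) =
            TensorProduct.assoc ℂ A A A ((id ⊗ₘ H.canonicalMaps.etr.flip b) w ⊗ₜ y) := by
        intro w
        induction w with
        | zero => simp
        | add x y hx hy => simp only [map_add, add_tmul, hx, hy]
        | tmul x y => simp
      rw [onFstTwo_tmul, h8]
      simp [Q]
  refine LinearMap.ext_on H.span_sndSlice_T₁ ?_
  rintro _ ⟨z, f, rfl⟩
  induction z with
  | zero => simp
  | add x y hx hy => rw [map_add, map_add, map_add, map_add, hx, hy]
  | tmul d a =>
    have h8 := congrArg (sndSlice f) ((TensorProduct.assoc ℂ A A A).injective (h6 d a))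
    rw [sndSlice_map, sndSlice_map] at h8
    exact h8

lemma fstSlice_onFstTwo_lact_E (f : A →ₗ[ℂ] ℂ) (b : A) (z : A ⊗[ℂ] A) :
    fstSlice f (onFstTwo (lact H.E) (b ⊗ₜ z)) = (H.canonicalMaps.rightLeg f b ⊗ₘ id) z := by
  induction z with
  | zero => simp
  | add x y hx hy => simp only [map_add, tmul_add, hx, hy]
  | tmul p q => rw [onFstTwo_tmul, fstSlice_assoc]; rfl

lemma map_sndSlice_onLastTwo_ract_E (f : A →ₗ[ℂ] ℂ) (b : A) (z : A ⊗[ℂ] A) :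
    (id ⊗ₘ sndSlice f) (onLastTwo (ract H.E) (TensorProduct.assoc ℂ A A A (z ⊗ₜ b))) =
      (id ⊗ₘ H.canonicalMaps.leftLeg f b) z := by
  induction z with
  | zero => simp
  | add x y hx hy => simp only [map_add, add_tmul, hx, hy]
  | tmul p q => rw [assoc_tmul, onLastTwo_tmul, map_tmul]; rfl

lemma E_comm_ract (z : A ⊗[ℂ] (A ⊗[ℂ] A)) :
    onFstTwo (ract H.E) (onLastTwo (ract H.E) z) = onLastTwo (ract H.E) (onFstTwo (ract H.E) z) :=
  tensor₃_ext H.nondegenerate fun y => by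
    have h1 := LinearMap.congr_fun H.E_comm y
    rw [comp_apply, comp_apply] at h1
    rw [← mul_onFstTwo (mul_lact H.E), ← mul_onLastTwo (mul_lact H.E),
      ← mul_onLastTwo (mul_lact H.E), ← mul_onFstTwo (mul_lact H.E), h1]

theorem canonicalMaps_isWeakHopf : H.canonicalMaps.IsWeakHopf where
  mul_assoc := mul_assoc
  left_nondeg := H.nondegenerate.1
  right_nondeg := H.nondegenerate.2
  span_mul := by
    have h1 : LinearMap.range (LinearMap.mul' ℂ A) = ⊤ := H.idempotent
    rw [eq_top_iff, ← h1]
    rintro _ ⟨z, rfl⟩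
    induction z with
    | zero => simp
    | add x y hx hy => rw [map_add]; exact add_mem hx hy
    | tmul a b => exact Submodule.subset_span ⟨a, b, rfl⟩
  R_T₁ a b c := tensor_ext H.nondegenerate fun y => by
    change (mulRight ℂ b ⊗ₘ id) (H.T₁ (a ⊗ₜ c)) * y = (id ⊗ₘ mulRight ℂ c) (H.T₄ (b ⊗ₜ a)) * y
    rw [map_mulRight_id_mul, map_id_mulRight_mul, T₁_tmul_mul, T₄_tmul_mul, map_map, map_map]
    simp only [id_comp, comp_id]
  L_T₃ a b c := tensor_ext H.nondegenerate fun y => by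
    change (mulLeft ℂ c ⊗ₘ id) (H.T₃ (a ⊗ₜ b)) * y = (id ⊗ₘ mulLeft ℂ b) (H.T₂ (c ⊗ₜ a)) * y
    rw [map_mulLeft_id_mul, map_id_mulLeft_mul, T₃_tmul_mul, T₂_tmul_mul, map_map, map_map]
    simp only [id_comp, comp_id]
  R_T₂ a b c := H.T₂_mul_tensorOne a b c
  R_T₃ a b c := H.T₃_mul_oneTensor a b c
  R_T₂_snd a b c := tensor_ext H.nondegenerate fun y => by
    change (id ⊗ₘ mulRight ℂ b) (H.T₂ (c ⊗ₜ a)) * y = (mulLeft ℂ c ⊗ₘ id) (H.T₁ (a ⊗ₜ b)) * y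
    rw [map_mulLeft_id_mul, map_id_mulRight_mul, T₁_tmul_mul, T₂_tmul_mul]
  lΔ_tmul a b c := tensor_ext H.nondegenerate fun y => by
    change lact (H.Δ a) (b ⊗ₜ c) * y = (mulRight ℂ b ⊗ₘ id) (H.T₁ (a ⊗ₜ c)) * y
    rw [map_mulRight_id_mul, T₁_tmul_mul, ← lact_mul H.nondegenerate, tmul_mul_eq_map, map_map]
    simp only [id_comp, comp_id]
  rΔ_tmul a b c := tensor_ext H.nondegenerate fun y => by
    change ract (H.Δ a) (b ⊗ₜ c) * y = (id ⊗ₘ mulLeft ℂ c) (H.T₂ (b ⊗ₜ a)) * y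
    rw [map_id_mulLeft_mul, T₂_tmul_mul, ← mul_lact, tmul_mul_eq_map, map_map]
    simp only [id_comp, comp_id]
  T₁_mul a b c := tensor_ext H.nondegenerate fun y => by
    change H.T₁ ((a * b) ⊗ₜ c) * y = lact (H.Δ a) (H.T₁ (b ⊗ₜ c)) * y
    rw [← lact_mul H.nondegenerate, T₁_tmul_mul, T₁_tmul_mul, lact_Δ_mul]
  T₂_mul a b c := tensor_ext H.nondegenerate fun y => by
    change H.T₂ (c ⊗ₜ (a * b)) * y = ract (H.Δ b) (H.T₂ (c ⊗ₜ a)) * y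
    rw [← mul_lact, T₂_tmul_mul, T₂_tmul_mul, lact_Δ_mul]
  lE_R b c z := by
    change lact H.E ((mulRight ℂ b ⊗ₘ mulRight ℂ c) z) =
      (mulRight ℂ b ⊗ₘ mulRight ℂ c) (lact H.E z)
    rw [← mul_tmul_eq_map, ← mul_tmul_eq_map, lact_mul H.nondegenerate]
  rE_L b c z := by
    change ract H.E ((mulLeft ℂ b ⊗ₘ mulLeft ℂ c) z) = (mulLeft ℂ b ⊗ₘ mulLeft ℂ c) (ract H.E z)
    rw [← tmul_mul_eq_map, ← tmul_mul_eq_map, ract_mul H.nondegenerate]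
  L_lE a b c d := by
    change (mulLeft ℂ a ⊗ₘ mulLeft ℂ b) (lact H.E (c ⊗ₜ d)) =
      (mulRight ℂ c ⊗ₘ mulRight ℂ d) (ract H.E (a ⊗ₜ b))
    rw [← tmul_mul_eq_map, ← mul_tmul_eq_map, mul_lact]
  T₁_R₁ := H.T₁_R₁_apply
  T₂_R₂ := H.T₂_R₂_apply
  R₁_lE z := by
    change H.R₁ (lact H.E z) = H.R₁ z
    rw [← T₁_R₁_apply]; exact LinearMap.congr_fun H.R₁_T₁_R₁ z
  R₂_rE z := by
    change H.R₂ (ract H.E z) = H.R₂ z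
    rw [← T₂_R₂_apply]; exact LinearMap.congr_fun H.R₂_T₂_R₂ z
  lE_T₁ := H.lact_E_T₁
  rE_T₂ := H.ract_E_T₂
  counit_T₁ z := by
    induction z with
    | zero => simp
    | add x y hx hy => simp only [map_add, hx, hy]
    | tmul a b => rw [CanonicalMaps.mulT_tmul]; exact H.counit_left a b
  counit_T₂ z := by
    induction z with
    | zero => simp
    | add x y hx hy => simp only [map_add, hx, hy]
    | tmul a b => rw [CanonicalMaps.mulT_tmul]; exact H.counit_right a b
  L_R₁ := H.R₁_spec
  R_R₂ := H.R₂_spec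
  es_T₁ := H.map_es_T₁
  etr_T₂ := H.map_etr_T₂
  T₁_rightLeg f b z := by
    have h1 := congrArg (fstSlice f) (LinearMap.congr_fun H.Δ_right_leg (b ⊗ₜ z))
    simp only [comp_apply, onLastTwo_tmul, lact_E_T₁, fstSlice_onLastTwo,
      fstSlice_onFstTwo_lact_E] at h1
    exact h1.symm
  T₂_leftLeg f b z := by
    have h1 := congrArg (id ⊗ₘ sndSlice f)
      (LinearMap.congr_fun H.Δ_left_leg (TensorProduct.assoc ℂ A A A (z ⊗ₜ b)))
    simp only [comp_apply, onFstTwo_assoc, E_comm_ract, ract_E_T₂, map_sndSlice_onFstTwo,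
      map_sndSlice_onLastTwo_ract_E] at h1
    exact h1.symm
  lE_rightLeg f b z := by
    have h1 := congrArg (fstSlice f) (LinearMap.congr_fun H.E_comm (b ⊗ₜ z))
    simp only [comp_apply, onLastTwo_tmul, fstSlice_onLastTwo, fstSlice_onFstTwo_lact_E] at h1
    exact h1.symm
  rE_leftLeg f b z := by
    have h1 := congrArg (id ⊗ₘ sndSlice f)
      (H.E_comm_ract (TensorProduct.assoc ℂ A A A (z ⊗ₜ b)))
    simp only [onFstTwo_assoc, map_sndSlice_onFstTwo, map_sndSlice_onLastTwo_ract_E] at h1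
    exact h1
  R_R₂_T₂ := H.map_R₂_T₂
  L_R₁_T₁ := H.map_R₁_T₁
  full_left := H.span_sndSlice_T₁
  full_right := H.span_fstSlice_T₂

/-- The antipode relation of a left integral. -/
lemma IsLeftIntegral.S_sndSlice_T₁ {H : RegularWeakMultiplierHopfAlgebra A} {φ : A →ₗ[ℂ] ℂ}
    (hφ : H.IsLeftIntegral φ) (x q : A) :
    H.S (sndSlice φ (H.T₁ (x ⊗ₜ q))) = sndSlice φ (H.T₃ (q ⊗ₜ x)) := by
  refine H.canonicalMaps_isWeakHopf.S_sndSlice_T₁ (fun a b => ?_) x q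
  obtain ⟨b', hb'⟩ := (hφ.2 a (H.targetMap b) ⟨b, rfl⟩).2
  exact ⟨b', fun p => (congrArg (fun m => ract m p) hb').symm⟩

/-- The antipode relation of a right integral. -/
lemma IsRightIntegral.S_fstSlice_T₂ {H : RegularWeakMultiplierHopfAlgebra A} {ψ : A →ₗ[ℂ] ℂ}
    (hψ : H.IsRightIntegral ψ) (x p : A) :
    H.S (fstSlice ψ (H.T₂ (x ⊗ₜ p))) = fstSlice ψ (H.T₄ (p ⊗ₜ x)) := by
  refine H.canonicalMaps_isWeakHopf.S_fstSlice_T₂ (fun a b => ?_) x p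
  obtain ⟨b', hb'⟩ := (hψ.2 a (H.sourceMap b) ⟨b, rfl⟩).1
  exact ⟨b', fun p => (congrArg (fun m => lact m p) hb').symm⟩

end RegularWeakMultiplierHopfAlgebra
end WMHA

theorem mainTheorem6 {A : Type*} [NonUnitalRing A] [Module ℂ A] [IsScalarTower ℂ A A]
    [SMulCommClass ℂ A A] (H : WMHA.RegularWeakMultiplierHopfAlgebra A)
    (φ ψ : A →ₗ[ℂ] ℂ) (hφ : H.IsLeftIntegral φ) (hψ : H.IsRightIntegral ψ) (p q : A) :
    (∀ x : A,
      ψ (x * WMHA.sliceSnd φ (H.sndΔMul H.S p q)) =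
        φ (x * WMHA.sliceFst ψ (H.fstΔMul H.S.symm q p))) ∧
    (∀ x : A,
      ψ (WMHA.sliceSnd φ (H.mulSndΔ H.S.symm q p) * x) =
        φ (WMHA.sliceFst ψ (H.mulFstΔ H.S p q) * x)) ∧
    (∀ x : A,
      ψ (x * WMHA.sliceSnd φ (H.mulSndΔ H.S q p)) =
        φ (WMHA.sliceFst ψ (H.fstΔMul H.S q p) * x)) ∧
    (∀ x : A,
      ψ (WMHA.sliceSnd φ (H.sndΔMul H.S.symm p q) * x) =
        φ (x * WMHA.sliceFst ψ (H.mulFstΔ H.S.symm p q))) := by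
  have h := H.canonicalMaps_isWeakHopf
  exact ⟨h.integral_right_right hφ.S_sndSlice_T₁ hψ.S_fstSlice_T₂ p q,
    h.integral_left_left hφ.S_sndSlice_T₁ hψ.S_fstSlice_T₂ p q,
    h.integral_right_left hφ.S_sndSlice_T₁ hψ.S_fstSlice_T₂ p q,
    h.integral_left_right hφ.S_sndSlice_T₁ hψ.S_fstSlice_T₂ p q⟩
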